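/- **Setting.** Consider an episodic MDP with countable state space $\mathcal X$, countable action space $\mathcal A$, horizon $H\ge 1$, reward distributions $R_h(x,a)\in\Delta([0,1])$, transitions $P_h(x,a)\in\Delta(\mathcal X)$ and initial distribution $d_1$, such that $\sum_{h=1}^H r_h\in[0,1]$ almost surely under every policy. Let $J(\pi)=\mathbb E^\pi[\sum_h r_h]$ and $d_h^\pi(x,a)=\mathbb P^\pi[x_h=x,a_h=a]$. Let $\pi^\star$ be a deterministic policy that maximizes $V_h^\pi(x)$ over all randomized policies $\pi$ at all $h$ and $x$, and $Q^\star=Q^{\pi^\star}$. Let $\mathcal F$ be a finite class of functions $f=(f_1,\dots,f_H)$, $f_h:\mathcal X\times\mathcal A\to[0,1]$ (with $f_{H+1}:=0$), for which greedy policies $\pi_{f,h}(x)\in\operatorname{argmax}_a f_h(x,a)$ exist; fix an arbitrary tie-breaking rule and let $\Pi=\{\pi_f: f\in\mathcal F\}$. Let $\mathcal W$ be a finite class of functions $w=(w_1,\dots,w_H)$, $w_h:\mathcal X\times\mathcal A\to[0,\infty]$. Let $$C_{\mathsf{cov}}=\inf_{\mu_1,\dots,\mu_H\in\Delta(\mathcal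 X\times\mathcal A)}\ \sup_{\pi\in\Pi,\,h}\ \Big\|\frac{d_h^\pi}{\mu_h}\Big\|_\infty .$$ Ratios use the conventions $x/0=+\infty$ for $x>0$, $0/0=1$ and $1/\infty=0$. **Assumptions.** (i) $Q^\star\in\mathcal F$. (ii) For all $\pi,\pi'\in\Pi$ and all $h$ there is $w\in\mathcal W$ with $w_h=d_h^{\pi}/d_h^{\pi'}$. **Augmented class.** $\overline{\mathcal W}$ is the set of all functions $(h,x,a)\mapsto \big(\tfrac1t\sum_{s=1}^t w^{(s)}_h(x,a)\big)^{-1}$ with $1\le t\le T$ and $w^{(1)},\dots,w^{(t)}\in\mathcal W$. **Algorithm (GLOW on $\mathcal F,\overline{\mathcal W}$ with parameters $T,K,\gamma$ and confidence $\delta$).** Put $\gamma_t=\gamma t$, $\alpha_t=8/\gamma_t$ and $\beta_t=\frac{36\gamma_t}{K(t-1)}\log\big(6|\mathcal F||\overline{\mathcal W}|TH/\delta\big)$. In round $t=1,\dots,T$ let $\widehat{\mathbb E}_t$ be the empirical mean over the $K(t-1)$ trajectories collected before. With $\check w_h=\min\{w_h,\gamma_t\}$, let $\mathcal F^{(t)}$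 be the set of $f\in\mathcal F$ such that for all $h$ and all $w\in\overline{\mathcal W}$ $$\widehat{\mathbb E}_t\Big[\big(f_h(x_h,a_h)-r_h-\max_{a'}f_{h+1}(x_{h+1},a')\big)\check w_h(x_h,a_h)-\alpha_t\,\check w_h(x_h,a_h)^2\Big]\le\beta_t$$ (no constraint when $t=1$). Choose $f^{(t)}\in\operatorname{argmax}_{f\in\mathcal F^{(t)}}\widehat{\mathbb E}_t[f_1(x_1,\pi_{f,1}(x_1))]$ as a measurable function of the data, with arbitrary ties and arbitrarily in $\mathcal F$ if $\mathcal F^{(t)}=\emptyset$. Collect $K$ independent trajectories with $\pi^{(t)}=\pi_{f^{(t)}}$. The output is $\widehat\pi\sim\mathrm{Unif}(\pi^{(1)},\dots,\pi^{(T)})$. **Theorem.** There is an absolute constant $C_1>0$ and, for each $\kappa\ge1$, a constant $C_2>0$ depending only on $\kappa$, such that the following holds in the setting above, for all $\varepsilon\in(0,1]$ and $\delta\in(0,1)$. Write $X=H^2C_{\mathsf{cov}}/\varepsilon^2$ and $\ell=\log(e+X)$. Let $T,K\in\mathbb N$ satisfy $$C_1X\ell^2\le T\le\kappa\,C_1X\ell^2,\qquad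 2T\log\tfrac{6|\mathcal F||\mathcal W|HT}{\delta}\le K\le 2\kappa\,T\log\tfrac{6|\mathcal F||\mathcal W|HT}{\delta},$$ (so $T=\widetilde\Theta(H^2C_{\mathsf{cov}}/\varepsilon^2)$ and $K=\widetilde\Theta(T\log(|\mathcal F||\mathcal W|/\delta))$), and let $\gamma=\sqrt{C_{\mathsf{cov}}/T}$. Then, under assumptions (i) and (ii), with probability at least $1-\delta$ over the data collected by GLOW, $$\mathbb E_{\widehat\pi\sim\mathrm{Unif}(\pi^{(1)},\dots,\pi^{(T)})}\big[J(\pi^\star)-J(\widehat\pi)\big]\le\varepsilon,$$ and the number $N=TK$ of trajectories collected satisfies $$N\le C_2\,\frac{H^4C_{\mathsf{cov}}^2}{\varepsilon^4}\,\Big(1+\log\frac{|\mathcal F||\mathcal W|}{\delta}\Big)\,\ell^5 .$$ -/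

import Mathlib

open MeasureTheory
open scoped ENNReal

namespace Glow

/-- One step `(x_h, a_h, r_h)` of a trajectory; rewards lie in `[0,1]`. -/
abbrev Step (X A : Type*) := X × A × unitInterval

/-- A trajectory `(x_1, a_1, r_1), …, (x_H, a_H, r_H)`; layers are indexed by `Fin H`, from `0`. -/
abbrev Traj (X A : Type*) (H : ℕ) := Fin H → Step X A

/-- The data of `s` rounds with `K` trajectories each, that is, `s * K` trajectories in total. -/
abbrev Dataset (X A : Type*) (H K s : ℕ) := Fin s → Fin K → Traj X A H

/-- Randomized (Markov, layer-dependent) policies. -/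
abbrev Policy (X A : Type*) (H : ℕ) := Fin H → X → PMF A

/-- Candidate value functions `f = (f_1, …, f_H)`; the convention is `f_{H+1} = 0`. -/
abbrev ValueFn (X A : Type*) (H : ℕ) := Fin H → X → A → ℝ

/-- Weight functions `w = (w_1, …, w_H)`; the value `+∞` is allowed. -/
abbrev WeightFn (X A : Type*) (H : ℕ) := Fin H → X → A → ℝ≥0∞

/-- The deterministic policy that plays `p h x` in state `x` at layer `h`. -/
noncomputable def detPolicy {X A : Type*} {H : ℕ} (p : Fin H → X → A) : Policy X A H :=
  fun h x => PMF.pure (p h x)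

/-- An episodic Markov decision process with horizon `H`: reward distributions on `[0,1]`,
transition distributions and an initial state distribution. -/
structure MDP (X A : Type*) (H : ℕ) where
  R : Fin H → X → A → ProbabilityMeasure unitInterval
  P : Fin H → X → A → PMF X
  d₁ : PMF X

/-- The sum of the rewards of a (partial) trajectory. -/
def totalReward {X A : Type*} {n : ℕ} (τ : Fin n → Step X A) : ℝ :=
  ∑ i, ((τ i).2.2 : ℝ)

namespace MDP

variable {X A : Type*} [MeasurableSpace X] [MeasurableSpace A] {H : ℕ}

/-- The law of a trajectory that starts at layer `h` with state `x` and action `a`: the reward is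
drawn from `R_h(x,a)` and, independently of it, the next state is drawn from `P_h(x,a)` and the
trajectory is continued with the law `next`. -/
noncomputable def stepLaw (M : MDP X A H) (h : Fin H) {n : ℕ}
    (next : X → Measure (Fin n → Step X A)) (x : X) (a : A) :
    Measure (Fin (n + 1) → Step X A) :=
  ((M.R h x a : Measure unitInterval).prod ((M.P h x a).toMeasure.bind next)).map
    fun p => Fin.cons (α := fun _ => Step X A) (x, a, p.1) p.2

/-- The law of the last `n` steps of a trajectory under `π`, when the first of them (at the layer
with index `H - n`, counted from `0`) starts in the state `x`. -/
noncomputable def rollout (M : MDP X A H) (π : Policy X A H) :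
    (n : ℕ) → n ≤ H → X → Measure (Fin n → Step X A)
  | 0, _, _ => Measure.dirac Fin.elim0
  | n + 1, hn, x =>
      (π ⟨H - (n + 1), by omega⟩ x).toMeasure.bind
        (M.stepLaw ⟨H - (n + 1), by omega⟩ (M.rollout π n (by omega)) x)

/-- The law of a whole trajectory under `π`, with `x_1` drawn from `d₁`. -/
noncomputable def trajLaw (M : MDP X A H) (π : Policy X A H) : Measure (Traj X A H) :=
  M.d₁.toMeasure.bind (M.rollout π H le_rfl)

/-- `J(π)`, the expected total reward of `π`. -/
noncomputable def J (M : MDP X A H) (π : Policy X A H) : ℝ :=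
  ∫ τ, totalReward τ ∂(M.trajLaw π)

/-- `V_h^π(x)`, the expected reward from layer `h` on, given `x_h = x`. -/
noncomputable def V (M : MDP X A H) (π : Policy X A H) (h : Fin H) (x : X) : ℝ :=
  ∫ τ, totalReward τ ∂(M.rollout π (H - h) (by omega) x)

/-- `Q_h^π(x,a)`, the expected reward from layer `h` on, given `x_h = x` and `a_h = a`. -/
noncomputable def Q (M : MDP X A H) (π : Policy X A H) : ValueFn X A H :=
  fun h x a => ∫ τ, totalReward τ ∂(M.stepLaw h (M.rollout π (H - (h + 1)) (by omega)) x a)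

/-- The occupancy measure `d_h^π(x,a) = ℙ^π[x_h = x, a_h = a]`. -/
noncomputable def occ (M : MDP X A H) (π : Policy X A H) : WeightFn X A H :=
  fun h x a => M.trajLaw π {τ | (τ h).1 = x ∧ (τ h).2.1 = a}

/-- Rewards are normalized: `∑_h r_h ∈ [0,1]` almost surely, whatever policy is executed. -/
def RewardsNormalized (M : MDP X A H) : Prop :=
  ∀ π : Policy X A H, ∀ᵐ τ ∂(M.trajLaw π), totalReward τ ∈ Set.Icc (0 : ℝ) 1

/-- The deterministic policy `p` is optimal: it maximizes `V_h^π(x)` over all randomized policies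
at all layers and all states. -/
def IsOptimal (M : MDP X A H) (p : Fin H → X → A) : Prop :=
  ∀ (π : Policy X A H) (h : Fin H) (x : X), M.V π h x ≤ M.V (detPolicy p) h x

end MDP

/-- `π_f` is a greedy policy for each `f ∈ F`: `π_{f,h}(x) ∈ argmax_a f_h(x,a)`. The function
`greedy` is the (arbitrary) tie-breaking rule. -/
def IsGreedyRule {X A : Type*} {H : ℕ} (F : Set (ValueFn X A H))
    (greedy : ValueFn X A H → Fin H → X → A) : Prop :=
  ∀ f ∈ F, ∀ h x a, f h x a ≤ f h x (greedy f h x)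

/-- The induced policy class `Π = {π_f | f ∈ F}`. -/
def policyClass {X A : Type*} {H : ℕ} (F : Set (ValueFn X A H))
    (greedy : ValueFn X A H → Fin H → X → A) : Set (Policy X A H) :=
  {π | ∃ f ∈ F, π = detPolicy (greedy f)}

open Classical in
/-- The ratio `p / q` with the conventions `p / 0 = +∞` for `p > 0` and `0 / 0 = 1`. -/
noncomputable def ratio (p q : ℝ≥0∞) : ℝ≥0∞ :=
  if p = 0 ∧ q = 0 then 1 else p / q

/-- Density ratio realizability for pure policies: for all `π, π' ∈ Π` and all layers `h`, the
function `d_h^π / d_h^π'` belongs to `W_h = {w_h | w ∈ W}`. -/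
def DensityRatioRealizable {X A : Type*} [MeasurableSpace X] [MeasurableSpace A] {H : ℕ}
    (M : MDP X A H) (Pol : Set (Policy X A H)) (W : Set (WeightFn X A H)) : Prop :=
  ∀ π ∈ Pol, ∀ π' ∈ Pol, ∀ h, ∃ w ∈ W, ∀ x a, w h x a = ratio (M.occ π h x a) (M.occ π' h x a)

/-- The coverability coefficient `C_cov = inf_{μ_1,…,μ_H} sup_{π ∈ Π, h} ‖d_h^π / μ_h‖_∞`. -/
noncomputable def coverability {X A : Type*} [MeasurableSpace X] [MeasurableSpace A] {H : ℕ}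
    (M : MDP X A H) (Pol : Set (Policy X A H)) : ℝ≥0∞ :=
  ⨅ μ : Fin H → PMF (X × A), ⨆ π ∈ Pol, ⨆ h : Fin H, ⨆ x : X, ⨆ a : A,
    ratio (M.occ π h x a) (μ h (x, a))

/-- `Mixture(w¹, …, wᵗ; t)_h(x,a) = 1 / ((1/t) ∑_s wˢ_h(x,a))`, with `1/0 = +∞` and `1/∞ = 0`. -/
noncomputable def mixture {X A : Type*} {H t : ℕ} (w : Fin t → WeightFn X A H) :
    WeightFn X A H :=
  fun h x a => ((∑ s, w s h x a) / (t : ℝ≥0∞))⁻¹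

/-- The augmented class: all `Mixture(w¹, …, wᵗ; t)` with `w¹, …, wᵗ ∈ W` and `1 ≤ t ≤ T`. -/
def augmented {X A : Type*} {H : ℕ} (W : Set (WeightFn X A H)) (T : ℕ) :
    Set (WeightFn X A H) :=
  {v | ∃ t : ℕ, 1 ≤ t ∧ t ≤ T ∧ ∃ w : Fin t → WeightFn X A H, (∀ s, w s ∈ W) ∧ v = mixture w}

/-- The clipped weight `min {w, c}`, a real number. -/
noncomputable def clip (w : ℝ≥0∞) (c : ℝ) : ℝ := (min w (ENNReal.ofReal c)).toReal

/-- `max_{a'} f_{h+1}(x_{h+1}, a')` along the trajectory `τ`; it is `0` at the last layer. -/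
noncomputable def nextMax {X A : Type*} {H : ℕ} (f : ValueFn X A H) (h : Fin H)
    (τ : Traj X A H) : ℝ :=
  if hh : (h : ℕ) + 1 < H then ⨆ a', f ⟨h + 1, hh⟩ (τ ⟨h + 1, hh⟩).1 a' else 0

/-- `f_h(x_h,a_h) - r_h - max_{a'} f_{h+1}(x_{h+1},a')`. -/
noncomputable def residual {X A : Type*} {H : ℕ} (f : ValueFn X A H) (h : Fin H)
    (τ : Traj X A H) : ℝ :=
  f h (τ h).1 (τ h).2.1 - ((τ h).2.2 : ℝ) - nextMax f h τ

/-- The empirical expectation over the `K * s` trajectories of a dataset (`0` when it is empty). -/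
noncomputable def empMean {X A : Type*} {H K s : ℕ} (D : Dataset X A H K s)
    (g : Traj X A H → ℝ) : ℝ :=
  (∑ i, ∑ k, g (D i k)) / ((K : ℝ) * s)

/-- `γ⁽ᵗ⁾ = γ t` for the round `t = s + 1` that follows `s` completed rounds. -/
noncomputable def gammaAt (γ : ℝ) (s : ℕ) : ℝ := γ * ((s : ℝ) + 1)

/-- `α⁽ᵗ⁾ = 8 / γ⁽ᵗ⁾`, with `t = s + 1`. -/
noncomputable def alphaAt (γ : ℝ) (s : ℕ) : ℝ := 8 / gammaAt γ s

/-- `β⁽ᵗ⁾ = 36 γ⁽ᵗ⁾ / (K (t - 1)) * log (6 |F| |W| T H / δ)`, with `t = s + 1`. In the first round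
the dataset is empty, and the constraint with threshold `β⁽¹⁾` reads `0 ≤ 0`. -/
noncomputable def betaAt {X A : Type*} {H : ℕ} (F : Set (ValueFn X A H))
    (W : Set (WeightFn X A H)) (T K : ℕ) (γ δ : ℝ) (s : ℕ) : ℝ :=
  36 * gammaAt γ s / ((K : ℝ) * s) *
    Real.log (6 * (F.ncard : ℝ) * (W.ncard : ℝ) * (T : ℝ) * (H : ℝ) / δ)

/-- The confidence set `F⁽ᵗ⁾`, `t = s + 1`, given the data of the first `s` rounds. -/
def confidenceSet {X A : Type*} {H : ℕ} (F : Set (ValueFn X A H)) (W : Set (WeightFn X A H))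
    (T K : ℕ) (γ δ : ℝ) {s : ℕ} (D : Dataset X A H K s) : Set (ValueFn X A H) :=
  {f | f ∈ F ∧ ∀ h : Fin H, ∀ w ∈ W,
    empMean D (fun τ =>
      residual f h τ * clip (w h (τ h).1 (τ h).2.1) (gammaAt γ s)
        - alphaAt γ s * (clip (w h (τ h).1 (τ h).2.1) (gammaAt γ s)) ^ 2)
      ≤ betaAt F W T K γ δ s}

/-- The optimistic objective `Ê_{x_1 ∼ D}[f_1(x_1, π_{f,1}(x_1))]`. -/
noncomputable def optimisticValue {X A : Type*} {H : ℕ} [NeZero H]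
    (greedy : ValueFn X A H → Fin H → X → A) {K s : ℕ} (D : Dataset X A H K s)
    (f : ValueFn X A H) : ℝ :=
  empMean D fun τ => f 0 (τ 0).1 (greedy f 0 (τ 0).1)

/-- `sel` is an implementation of the choice of `f⁽ᵗ⁾` in the algorithm, `t = s + 1`, as a function
of the data of the first `s` rounds: it takes values in `F`, depends measurably on the data, and is
a maximizer of the optimistic objective over the confidence set (ties are broken arbitrarily, and
the choice is arbitrary when the confidence set is empty). -/
structure IsGlowSelection {X A : Type*} [MeasurableSpace X] [MeasurableSpace A] {H : ℕ} [NeZero H]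
    (F : Set (ValueFn X A H)) (W : Set (WeightFn X A H))
    (greedy : ValueFn X A H → Fin H → X → A) (T K : ℕ) (γ δ : ℝ)
    (sel : (s : ℕ) → Dataset X A H K s → ValueFn X A H) : Prop where
  mem : ∀ s D, sel s D ∈ F
  measurable : ∀ s f, MeasurableSet {D | sel s D = f}
  argmax : ∀ s D, (confidenceSet F W T K γ δ D).Nonempty →
    sel s D ∈ confidenceSet F W T K γ δ D ∧
      ∀ f ∈ confidenceSet F W T K γ δ D,
        optimisticValue greedy D f ≤ optimisticValue greedy D (sel s D)

/-- The law of the data of the first `s` rounds, when each round executes the policy that `pol`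
prescribes from the previous data, and collects `K` independent trajectories with it. -/
noncomputable def dataLaw {X A : Type*} [MeasurableSpace X] [MeasurableSpace A] {H : ℕ}
    (M : MDP X A H) (K : ℕ) (pol : (s : ℕ) → Dataset X A H K s → Policy X A H) :
    (s : ℕ) → Measure (Dataset X A H K s)
  | 0 => Measure.dirac Fin.elim0
  | s + 1 => (dataLaw M K pol s).bind fun D =>
      (Measure.pi fun _ : Fin K => M.trajLaw (pol s D)).map
        fun τs => Fin.snoc (α := fun _ => Fin K → Traj X A H) D τs

/-- The policy that the algorithm executes after `s` completed rounds: `π_{f⁽ᵗ⁾}`, `t = s + 1`. -/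
noncomputable def glowPolicy {X A : Type*} {H K : ℕ} (greedy : ValueFn X A H → Fin H → X → A)
    (sel : (s : ℕ) → Dataset X A H K s → ValueFn X A H) (s : ℕ) (D : Dataset X A H K s) :
    Policy X A H :=
  detPolicy (greedy (sel s D))

/-- The risk `E_{π̂ ∼ p}[J(π⋆) - J(π̂)]` of the output `π̂ ∼ p = Unif(π⁽¹⁾, …, π⁽ᵀ⁾)`, as a function
of the data of all `T` rounds. -/
noncomputable def risk {X A : Type*} [MeasurableSpace X] [MeasurableSpace A] {H : ℕ}
    (M : MDP X A H) (πstar : Policy X A H) {K T : ℕ}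
    (pol : (s : ℕ) → Dataset X A H K s → Policy X A H) (D : Dataset X A H K T) : ℝ :=
  (∑ t : Fin T, (M.J πstar - M.J (pol t fun i => D (Fin.castLE t.isLt.le i)))) / T

end Glow

/-!
The regret of the algorithm is controlled by optimism together with a change of measure from the
historical data to the current policy.

*Optimism.* The Bellman error of `Q^⋆` vanishes (`MDP.IsOptimal.bellmanError_Q`). The quadratic
penalty in the constraints absorbs the fluctuations of its residuals, so `Q^⋆` stays in all
confidence sets with high probability (`empMean_penalizedResidual_le`). Hence the function `f`
selected in a round overestimates the optimal value up to the sampling error of the initial state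
(`integral_value_le_of_optimistic`), and by the performance difference identity
`MDP.integral_sub_J_eq` the regret of the round is at most the sum over `h` of the mean Bellman
error of `f` under the occupancy `d` of its own greedy policy.

*Change of measure.* Let `d̄` be the average occupancy of the earlier rounds. The weight `d / d̄` is
a mixture of pure density ratios, so it belongs to the augmented class. Being in the confidence set,
`f` has a small Bellman error under `d̄` when reweighted by the clipped version of `d / d̄`
(`sum_bellmanError_clip_le`). The loss from clipping and the second moment of the clipped weight are
both at most a multiple of `∑ d² / (d + γ S)`, where `S` is the sum of the earlier occupancies
(`exists_augmented_changeOfMeasure`). If all occupancies are at most `C μ` then `d² / (d + γ S)` is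
at most `2 C μ / γ` times the increment of `log (1 + S / (C μ))`, so the sum over the rounds is
`O(C log T / γ)` (`sum_sq_div_le`). With `γ = √(C / T)` the average regret is
`O(H √(C / T) log T)`.

*Concentration.* Rounds are adaptive, but within a round the trajectories are independent given the
past. For `|g| ≤ 1` the inequality `exp u ≤ 1 + u + u²` makes the exponential of the sum of `g`
minus its first and second conditional moments a supermartingale, and Markov's inequality gives a
Freedman-type bound (`dataLaw_excess_gt_le`). It is applied to finitely many functions: penalized
residuals and initial values, with both signs, for each round, layer, `f` and weight. The
logarithm of the size of the augmented class is at most of order `T log |W|`, which is why `K` is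
of order `T`.
-/

set_option linter.unusedSectionVars false

namespace Glow

/-! ### Integrals of bounded functions -/

theorem integrable_of_bounded {α : Type*} [MeasurableSpace α] {μ : Measure α} [IsFiniteMeasure μ]
    {φ : α → ℝ} (hφ : Measurable φ) {C : ℝ} (hC : ∀ b, |φ b| ≤ C) : Integrable φ μ :=
  Integrable.of_bound hφ.aestronglyMeasurable C (Filter.Eventually.of_forall hC)

theorem abs_integral_le_of_bounded {α : Type*} [MeasurableSpace α] {μ : Measure α}
    [IsProbabilityMeasure μ] {φ : α → ℝ} {C : ℝ} (hC : ∀ b, |φ b| ≤ C) : |∫ b, φ b ∂μ| ≤ C := by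
  have := norm_integral_le_of_norm_le_const (μ := μ) (f := φ) (C := C)
    (Filter.Eventually.of_forall hC)
  simpa using this

theorem integral_bind_of_bounded {α β : Type*} [MeasurableSpace α] [MeasurableSpace β]
    {μ : Measure α} [IsProbabilityMeasure μ] {κ : α → Measure β} (hκ : Measurable κ)
    (hp : ∀ a, IsProbabilityMeasure (κ a)) {φ : β → ℝ} (hφ : Measurable φ) {C : ℝ}
    (hC : ∀ b, |φ b| ≤ C) :
    ∫ b, φ b ∂(μ.bind κ) = ∫ a, ∫ b, φ b ∂(κ a) ∂μ := by
  obtain ⟨k, rfl⟩ : ∃ k : ProbabilityTheory.Kernel α β, κ = k := ⟨⟨κ, hκ⟩, rfl⟩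
  have : IsProbabilityMeasure (μ.bind k) :=
    isProbabilityMeasure_bind hκ.aemeasurable (Filter.Eventually.of_forall hp)
  have hi : Integrable φ (μ.bind k) :=
    Integrable.of_bound hφ.aestronglyMeasurable C (Filter.Eventually.of_forall hC)
  rw [Measure.comp_eq_comp_const_apply] at hi ⊢
  simpa using ProbabilityTheory.Kernel.integral_comp hi

theorem ae_bind_of_forall {α β : Type*} [MeasurableSpace α] [MeasurableSpace β]
    {μ : Measure α} {κ : α → Measure β} (hκ : Measurable κ) {p : β → Prop}
    (hp : MeasurableSet {b | p b}) (h : ∀ᵐ a ∂μ, ∀ᵐ b ∂(κ a), p b) :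
    ∀ᵐ b ∂(μ.bind κ), p b := by
  rw [ae_iff, show {a | ¬p a} = {b | p b}ᶜ from rfl, Measure.bind_apply hp.compl hκ.aemeasurable]
  exact (lintegral_eq_zero_iff' ((Measure.measurable_coe hp.compl).comp hκ).aemeasurable).2 h

namespace MDP

variable {X A : Type*} [Countable X] [MeasurableSpace X] [DiscreteMeasurableSpace X]
  [Countable A] [MeasurableSpace A] [DiscreteMeasurableSpace A] {H : ℕ}

/-! ### The law of a trajectory -/

theorem measurable_cons_step {n : ℕ} (x : X) (a : A) :
    Measurable fun p : unitInterval × (Fin n → Step X A) =>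
      (Fin.cons (α := fun _ => Step X A) (x, a, p.1) p.2 : Fin (n + 1) → Step X A) := by
  refine measurable_pi_iff.2 fun i => ?_
  refine Fin.cases ?_ (fun j => ?_) i
  · simp only [Fin.cons_zero]; fun_prop
  · simp only [Fin.cons_succ]; fun_prop

theorem isProbabilityMeasure_bind_pmf {β : Type*} [MeasurableSpace β] (p : PMF X)
    {κ : X → Measure β} (h : ∀ x, IsProbabilityMeasure (κ x)) :
    IsProbabilityMeasure (p.toMeasure.bind κ) :=
  isProbabilityMeasure_bind Measurable.of_discrete.aemeasurable (Filter.Eventually.of_forall h)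

theorem isProbabilityMeasure_stepLaw (M : MDP X A H) (h : Fin H) {n : ℕ}
    {next : X → Measure (Fin n → Step X A)} (hn : ∀ x, IsProbabilityMeasure (next x))
    (x : X) (a : A) : IsProbabilityMeasure (M.stepLaw h next x a) := by
  have := isProbabilityMeasure_bind_pmf (M.P h x a) hn
  exact Measure.isProbabilityMeasure_map (measurable_cons_step x a).aemeasurable

instance isProbabilityMeasure_rollout (M : MDP X A H) (π : Policy X A H) (n : ℕ) (hn : n ≤ H)
    (x : X) : IsProbabilityMeasure (M.rollout π n hn x) := by
  induction n generalizing x with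
  | zero => rw [rollout]; infer_instance
  | succ n ih =>
    rw [rollout]
    exact isProbabilityMeasure_bind_pmf _
      fun a => isProbabilityMeasure_stepLaw M _ (fun y => ih (by omega) y) x a

instance isProbabilityMeasure_trajLaw (M : MDP X A H) (π : Policy X A H) :
    IsProbabilityMeasure (M.trajLaw π) :=
  isProbabilityMeasure_bind_pmf _ fun _ => inferInstance

theorem integral_stepLaw (M : MDP X A H) (h : Fin H) {n : ℕ}
    {next : X → Measure (Fin n → Step X A)} (hn : ∀ x, IsProbabilityMeasure (next x))
    (x : X) (a : A) {φ : (Fin (n + 1) → Step X A) → ℝ} (hφ : Measurable φ) {C : ℝ}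
    (hC : ∀ b, |φ b| ≤ C) :
    ∫ τ, φ τ ∂(M.stepLaw h next x a) =
      ∫ r, ∫ y, ∫ σ, φ (Fin.cons (α := fun _ => Step X A) (x, a, r) σ) ∂(next y)
        ∂(M.P h x a).toMeasure ∂(M.R h x a : Measure unitInterval) := by
  have := isProbabilityMeasure_bind_pmf (M.P h x a) hn
  have hm : Measurable fun p : unitInterval × (Fin n → Step X A) =>
      φ (Fin.cons (α := fun _ => Step X A) (x, a, p.1) p.2) :=
    hφ.comp (measurable_cons_step x a)
  rw [stepLaw, integral_map (measurable_cons_step x a).aemeasurable hφ.aestronglyMeasurable,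
    integral_prod _ (Integrable.of_bound hm.aestronglyMeasurable C
      (Filter.Eventually.of_forall fun p => hC _))]
  refine integral_congr_ae (Filter.Eventually.of_forall fun r => ?_)
  exact integral_bind_of_bounded Measurable.of_discrete hn
    (hm.comp measurable_prodMk_left) (fun b => hC _)

/-- First-step decomposition: the action is drawn from `π`, then the step law applies. -/
theorem integral_rollout_succ (M : MDP X A H) (π : Policy X A H) (n : ℕ) (hn : n + 1 ≤ H) (x : X)
    {φ : (Fin (n + 1) → Step X A) → ℝ} (hφ : Measurable φ) {C : ℝ} (hC : ∀ b, |φ b| ≤ C) :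
    ∫ τ, φ τ ∂(M.rollout π (n + 1) hn x) =
      ∫ a, ∫ τ, φ τ ∂(M.stepLaw ⟨H - (n + 1), by omega⟩ (M.rollout π n (by omega)) x a)
        ∂(π ⟨H - (n + 1), by omega⟩ x).toMeasure := by
  rw [rollout]
  exact integral_bind_of_bounded Measurable.of_discrete
    (isProbabilityMeasure_stepLaw M _ (fun _ => inferInstance) x) hφ hC

theorem ae_stepLaw_of_forall (M : MDP X A H) (h : Fin H) {n : ℕ}
    {next : X → Measure (Fin n → Step X A)} (hn : ∀ x, IsProbabilityMeasure (next x))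
    (x : X) (a : A) {p : (Fin (n + 1) → Step X A) → Prop} (hp : MeasurableSet {τ | p τ})
    (hs : ∀ r y, ∀ᵐ σ ∂(next y), p (Fin.cons (α := fun _ => Step X A) (x, a, r) σ)) :
    ∀ᵐ τ ∂(M.stepLaw h next x a), p τ := by
  have := isProbabilityMeasure_bind_pmf (M.P h x a) hn
  have hm := hp.preimage (measurable_cons_step (n := n) x a)
  rw [stepLaw, ae_map_iff (measurable_cons_step x a).aemeasurable hp]
  refine (Measure.ae_prod_iff_ae_ae hm).2 (Filter.Eventually.of_forall fun r => ?_)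
  exact ae_bind_of_forall Measurable.of_discrete (hm.preimage measurable_prodMk_left)
    (Filter.Eventually.of_forall fun y => hs r y)

theorem ae_rollout_zero_fst (M : MDP X A H) (π : Policy X A H) (n : ℕ) (hn : n + 1 ≤ H) (x : X) :
    ∀ᵐ τ ∂(M.rollout π (n + 1) hn x), (τ 0).1 = x := by
  have hm : MeasurableSet {τ : Fin (n + 1) → Step X A | (τ 0).1 = x} :=
    measurableSet_eq_fun (by fun_prop) measurable_const
  rw [rollout]
  refine ae_bind_of_forall Measurable.of_discrete hm (Filter.Eventually.of_forall fun a => ?_)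
  exact ae_stepLaw_of_forall M _ (fun _ => inferInstance) x a hm
    fun r y => Filter.Eventually.of_forall fun σ => by simp

theorem ae_rollout_action (M : MDP X A H) (p : Fin H → X → A) (n : ℕ) (hn : n ≤ H) (x : X) :
    ∀ᵐ τ ∂(M.rollout (detPolicy p) n hn x),
      ∀ i : Fin n, (τ i).2.1 = p ⟨H - n + i, by omega⟩ (τ i).1 := by
  induction n generalizing x with
  | zero => exact Filter.Eventually.of_forall fun τ i => i.elim0
  | succ n ih =>
    have hm : MeasurableSet {τ : Fin (n + 1) → Step X A |
        ∀ i : Fin (n + 1), (τ i).2.1 = p ⟨H - (n + 1) + i, by omega⟩ (τ i).1} := by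
      rw [Set.ofPred_forall]
      refine MeasurableSet.iInter fun i => measurableSet_eq_fun (by fun_prop) ?_
      exact (Measurable.of_discrete (f := p ⟨H - (n + 1) + i, by omega⟩)).comp (by fun_prop)
    rw [rollout, detPolicy, PMF.toMeasure_pure, Measure.dirac_bind Measurable.of_discrete]
    refine ae_stepLaw_of_forall M _ (fun _ => inferInstance) x _ hm fun r y => ?_
    filter_upwards [ih (by omega) y] with σ hσ i
    refine Fin.cases ?_ (fun j => ?_) i
    · simp
    · simp only [Fin.cons_succ, hσ j, Fin.val_succ]
      congr 2
      omega

theorem ae_trajLaw_action (M : MDP X A H) (p : Fin H → X → A) :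
    ∀ᵐ τ ∂(M.trajLaw (detPolicy p)), ∀ h : Fin H, (τ h).2.1 = p h (τ h).1 := by
  have hm : MeasurableSet {τ : Traj X A H | ∀ h : Fin H, (τ h).2.1 = p h (τ h).1} := by
    rw [Set.ofPred_forall]
    refine MeasurableSet.iInter fun i => measurableSet_eq_fun (by fun_prop) ?_
    exact (Measurable.of_discrete (f := p i)).comp (by fun_prop)
  refine ae_bind_of_forall Measurable.of_discrete hm (Filter.Eventually.of_forall fun x => ?_)
  filter_upwards [ae_rollout_action M p H le_rfl x] with τ hτ h
  simpa using hτ h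

theorem integral_trajLaw (M : MDP X A H) (π : Policy X A H) {φ : Traj X A H → ℝ}
    (hφ : Measurable φ) {C : ℝ} (hC : ∀ b, |φ b| ≤ C) :
    ∫ τ, φ τ ∂(M.trajLaw π) =
      ∫ x, ∫ τ, φ τ ∂(M.rollout π H le_rfl x) ∂M.d₁.toMeasure :=
  integral_bind_of_bounded Measurable.of_discrete (fun _ => inferInstance) hφ hC

/-- The initial state has law `d₁`, whatever the policy. -/
theorem integral_trajLaw_zero_fst [NeZero H] (M : MDP X A H) (π : Policy X A H) {φ : X → ℝ}
    {C : ℝ} (hC : ∀ b, |φ b| ≤ C) :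
    ∫ τ, φ (τ 0).1 ∂(M.trajLaw π) = ∫ x, φ x ∂M.d₁.toMeasure := by
  have hm : Measurable fun τ : Traj X A H => φ (τ 0).1 :=
    (Measurable.of_discrete (f := φ)).comp (by fun_prop)
  rw [integral_trajLaw M π hm fun b => hC _]
  refine integral_congr_ae (Filter.Eventually.of_forall fun x => ?_)
  obtain ⟨n, rfl⟩ : ∃ n, H = n + 1 := ⟨H - 1, by have := NeZero.pos H; omega⟩
  have : ∀ᵐ τ ∂(M.rollout π (n + 1) le_rfl x), φ (τ 0).1 = φ x :=
    (ae_rollout_zero_fst M π n le_rfl x).mono fun τ hτ => by rw [hτ]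
  simp only
  rw [integral_congr_ae this, integral_const, probReal_univ, one_smul]

end MDP

/-! ### The tower property -/

/-- The value of `v` at the state that follows step `i` of a (partial) trajectory, and `0` when
`i` is the last step. -/
noncomputable def nextVal {X A : Type*} {n : ℕ} (v : X → ℝ) (τ : Fin n → Step X A) (i : Fin n) :
    ℝ :=
  if h : (i : ℕ) + 1 < n then v (τ ⟨i + 1, h⟩).1 else 0

/-- The Bellman error `f_h(x,a) - 𝔼[r_h + max_{a'} f_{h+1}(x_{h+1}, a') | x_h = x, a_h = a]`. -/
noncomputable def MDP.bellmanError {X A : Type*} [MeasurableSpace X] {H : ℕ} (M : MDP X A H)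
    (f : ValueFn X A H) (h : Fin H) (x : X) (a : A) : ℝ :=
  f h x a - ∫ r, (r : ℝ) ∂(M.R h x a : Measure unitInterval) -
    if hh : (h : ℕ) + 1 < H then ∫ y, ⨆ a', f ⟨h + 1, hh⟩ y a' ∂(M.P h x a).toMeasure else 0

namespace MDP

variable {X A : Type*} [Countable X] [MeasurableSpace X] [DiscreteMeasurableSpace X]
  [Countable A] [MeasurableSpace A] [DiscreteMeasurableSpace A] {H : ℕ}

theorem measurable_stateAction {n : ℕ} (G : X → A → ℝ) (i : Fin n) :
    Measurable fun τ : Fin n → Step X A => G (τ i).1 (τ i).2.1 :=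
  (Measurable.of_discrete (f := fun p : X × A => G p.1 p.2)).comp
    (g := fun p : X × A => G p.1 p.2) (f := fun τ : Fin n → Step X A => ((τ i).1, (τ i).2.1))
    (by fun_prop)

theorem measurable_nextVal {n : ℕ} (v : X → ℝ) (i : Fin n) :
    Measurable fun τ : Fin n → Step X A => nextVal v τ i := by
  unfold nextVal
  split_ifs with h
  · exact (Measurable.of_discrete (f := v)).comp (by fun_prop)
  · exact measurable_const

theorem measurable_reward {n : ℕ} (i : Fin n) :
    Measurable fun τ : Fin n → Step X A => ((τ i).2.2 : ℝ) := by
  fun_prop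

theorem abs_nextVal_le {n : ℕ} {v : X → ℝ} {C : ℝ} (hv : ∀ y, |v y| ≤ C) (τ : Fin n → Step X A)
    (i : Fin n) : |nextVal v τ i| ≤ C := by
  unfold nextVal
  split_ifs with h
  · exact hv _
  · simpa using (abs_nonneg _).trans (hv (τ i).1)

theorem abs_unitInterval_le (r : unitInterval) : |(r : ℝ)| ≤ 1 :=
  abs_le.2 ⟨by linarith [r.2.1], r.2.2⟩

/-- Tower property for rollouts: at layer `h`, which is step `i` of the rollout of the last `n`
steps, the reward and the value of the next state may be replaced by their conditional expectation
given the current state and action. -/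
theorem integral_rollout_tower (M : MDP X A H) (π : Policy X A H) {G : X → A → ℝ} {v : X → ℝ}
    {Cg Cv : ℝ} (hG : ∀ x a, |G x a| ≤ Cg) (hv : ∀ y, |v y| ≤ Cv) (h : Fin H) (m : X → A → ℝ)
    (n : ℕ) (hn : n ≤ H) (i : Fin n) (hi : (h : ℕ) = H - n + i)
    (hm : ∀ x a, m x a = ∫ r, (r : ℝ) ∂(M.R h x a : Measure unitInterval) +
      if (h : ℕ) + 1 < H then ∫ y, v y ∂(M.P h x a).toMeasure else 0) (x : X) :
    ∫ τ, G (τ i).1 (τ i).2.1 * ((τ i).2.2 + nextVal v τ i) ∂(M.rollout π n hn x) =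
      ∫ τ, G (τ i).1 (τ i).2.1 * m (τ i).1 (τ i).2.1 ∂(M.rollout π n hn x) := by
  have hmb : ∀ x a, |m x a| ≤ 1 + Cv := fun x a => by
    rw [hm]
    refine (abs_add_le _ _).trans (add_le_add (abs_integral_le_of_bounded abs_unitInterval_le) ?_)
    split_ifs with hh
    · exact abs_integral_le_of_bounded hv
    · simpa using (abs_nonneg _).trans (hv x)
  have b1 : ∀ (n : ℕ) (i : Fin n) (τ : Fin n → Step X A),
      |G (τ i).1 (τ i).2.1 * ((τ i).2.2 + nextVal v τ i)| ≤ Cg * (1 + Cv) := fun n i τ => by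
    rw [abs_mul]
    exact mul_le_mul (hG _ _) ((abs_add_le _ _).trans
      (add_le_add (abs_unitInterval_le _) (abs_nextVal_le hv τ i))) (abs_nonneg _)
      ((abs_nonneg _).trans (hG (τ i).1 (τ i).2.1))
  have b2 : ∀ (n : ℕ) (i : Fin n) (τ : Fin n → Step X A),
      |G (τ i).1 (τ i).2.1 * m (τ i).1 (τ i).2.1| ≤ Cg * (1 + Cv) := fun n i τ => by
    rw [abs_mul]
    exact mul_le_mul (hG _ _) (hmb _ _) (abs_nonneg _)
      ((abs_nonneg _).trans (hG (τ i).1 (τ i).2.1))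
  have m1 : ∀ (n : ℕ) (i : Fin n), Measurable fun τ : Fin n → Step X A =>
      G (τ i).1 (τ i).2.1 * ((τ i).2.2 + nextVal v τ i) := fun n i =>
    (measurable_stateAction G i).mul ((measurable_reward i).add (measurable_nextVal v i))
  have m2 : ∀ (n : ℕ) (i : Fin n), Measurable fun τ : Fin n → Step X A =>
      G (τ i).1 (τ i).2.1 * m (τ i).1 (τ i).2.1 := fun n i =>
    measurable_stateAction (fun x a => G x a * m x a) i
  induction n generalizing x with
  | zero => exact i.elim0
  | succ n ih =>
    rw [integral_rollout_succ M π n hn x (m1 _ i) (b1 _ i),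
      integral_rollout_succ M π n hn x (m2 _ i) (b2 _ i)]
    refine integral_congr_ae (Filter.Eventually.of_forall fun a => ?_)
    simp only
    rw [integral_stepLaw M _ (fun _ => inferInstance) x a (m1 _ i) (b1 _ i),
      integral_stepLaw M _ (fun _ => inferInstance) x a (m2 _ i) (b2 _ i)]
    induction i using Fin.cases with
    | succ j =>
      refine integral_congr_ae (Filter.Eventually.of_forall fun r => ?_)
      refine integral_congr_ae (Filter.Eventually.of_forall fun y => ?_)
      simp only
      have := ih (by omega) j (by simp only [Fin.val_succ] at hi; omega) y
      simp only [Fin.cons_succ]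
      rw [← this]
      refine integral_congr_ae (Filter.Eventually.of_forall fun σ => ?_)
      simp only [nextVal, Fin.val_succ, add_lt_add_iff_right]
      congr 2
    | zero =>
      -- the next state is the first state of the remaining rollout, which is drawn from `P_h`
      have hh : (⟨H - (n + 1), by omega⟩ : Fin H) = h := Fin.ext (by simpa using hi.symm)
      rw [hh]
      simp only [Fin.cons_zero, integral_const, probReal_univ, one_smul]
      have key : ∀ (r : unitInterval) (y : X),
          ∫ σ, G x a * ((r : ℝ) + nextVal v
            (Fin.cons (α := fun _ => Step X A) (x, a, r) σ : Fin (n + 1) → Step X A) 0)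
            ∂(M.rollout π n (by omega) y) =
          G x a * ((r : ℝ) + if (h : ℕ) + 1 < H then v y else 0) := by
        intro r y
        have hae : ∀ᵐ σ ∂(M.rollout π n (by omega) y), G x a * ((r : ℝ) + nextVal v
            (Fin.cons (α := fun _ => Step X A) (x, a, r) σ : Fin (n + 1) → Step X A) 0) =
            G x a * ((r : ℝ) + if (h : ℕ) + 1 < H then v y else 0) := by
          rcases n with _ | k
          · have : ¬ ((h : ℕ) + 1 < H) := by simp at hi; omega
            simp [nextVal, this]
          · have h1 : (h : ℕ) + 1 < H := by simp at hi; omega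
            filter_upwards [ae_rollout_zero_fst M π k (by omega) y] with σ hσ
            simp only [nextVal, Fin.val_zero, zero_add, lt_add_iff_pos_left, Nat.succ_pos, h1,
              if_true, dif_pos]
            rw [← hσ]
            rfl
        rw [integral_congr_ae hae, integral_const, probReal_univ, one_smul]
      simp only [key]
      rw [hm]
      have hvi : Integrable v (M.P h x a).toMeasure :=
        integrable_of_bounded Measurable.of_discrete hv
      have hri : Integrable (fun r : unitInterval => (r : ℝ)) (M.R h x a : Measure unitInterval) :=
        integrable_of_bounded (by fun_prop) abs_unitInterval_le
      split_ifs with h1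
      · simp only [integral_const_mul]
        congr 1
        simp_rw [integral_add (integrable_const _) hvi, integral_const, probReal_univ, one_smul]
        rw [integral_add hri (integrable_const _), integral_const, probReal_univ, one_smul]
      · simp [integral_const_mul]

theorem integral_trajLaw_tower (M : MDP X A H) (π : Policy X A H) {G : X → A → ℝ} {v : X → ℝ}
    {Cg Cv : ℝ} (hG : ∀ x a, |G x a| ≤ Cg) (hv : ∀ y, |v y| ≤ Cv) (h : Fin H) (m : X → A → ℝ)
    (hm : ∀ x a, m x a = ∫ r, (r : ℝ) ∂(M.R h x a : Measure unitInterval) +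
      if (h : ℕ) + 1 < H then ∫ y, v y ∂(M.P h x a).toMeasure else 0) :
    ∫ τ, G (τ h).1 (τ h).2.1 * ((τ h).2.2 + nextVal v τ h) ∂(M.trajLaw π) =
      ∫ τ, G (τ h).1 (τ h).2.1 * m (τ h).1 (τ h).2.1 ∂(M.trajLaw π) := by
  have hmb : ∀ x a, |m x a| ≤ 1 + Cv := fun x a => by
    rw [hm]
    refine (abs_add_le _ _).trans (add_le_add (abs_integral_le_of_bounded abs_unitInterval_le) ?_)
    split_ifs with hh
    · exact abs_integral_le_of_bounded hv
    · simpa using (abs_nonneg _).trans (hv x)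
  rw [integral_trajLaw M π (C := Cg * (1 + Cv)), integral_trajLaw M π (C := Cg * (1 + Cv))]
  · refine integral_congr_ae (Filter.Eventually.of_forall fun x => ?_)
    exact integral_rollout_tower M π hG hv h m H le_rfl h (by simp) hm x
  · exact measurable_stateAction (fun x a => G x a * m x a) h
  · intro τ
    rw [abs_mul]
    exact mul_le_mul (hG _ _) (hmb _ _) (abs_nonneg _)
      ((abs_nonneg _).trans (hG (τ h).1 (τ h).2.1))
  · exact (measurable_stateAction G h).mul ((measurable_reward h).add (measurable_nextVal v h))
  · intro τ
    rw [abs_mul]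
    exact mul_le_mul (hG _ _) ((abs_add_le _ _).trans
      (add_le_add (abs_unitInterval_le _) (abs_nextVal_le hv τ h))) (abs_nonneg _)
      ((abs_nonneg _).trans (hG (τ h).1 (τ h).2.1))

end MDP

/-! ### Residuals and Bellman errors -/

theorem iSup_mem_Icc {A : Type*} {g : A → ℝ} (hg : ∀ a, g a ∈ Set.Icc (0 : ℝ) 1) :
    ⨆ a, g a ∈ Set.Icc (0 : ℝ) 1 :=
  ⟨Real.iSup_nonneg fun a => (hg a).1, Real.iSup_le (fun a => (hg a).2) zero_le_one⟩

theorem iSup_eq_of_forall_le {A : Type*} {g : A → ℝ} {a₀ : A} (h : ∀ a, g a ≤ g a₀) :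
    ⨆ a, g a = g a₀ :=
  have : Nonempty A := ⟨a₀⟩
  le_antisymm (ciSup_le h) (le_ciSup ⟨g a₀, Set.forall_mem_range.2 h⟩ a₀)

/-- `max_{a'} f_{h+1}(y, a')`, with `f_{H+1} = 0`. -/
noncomputable def succMax {X A : Type*} {H : ℕ} (f : ValueFn X A H) (h : Fin H) (y : X) : ℝ :=
  if hh : (h : ℕ) + 1 < H then ⨆ a', f ⟨h + 1, hh⟩ y a' else 0

section

variable {X A : Type*} {H : ℕ} {f : ValueFn X A H}

theorem nextMax_eq_nextVal (f : ValueFn X A H) (h : Fin H) (τ : Traj X A H) :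
    nextMax f h τ = nextVal (succMax f h) τ h := by
  unfold nextMax nextVal succMax
  split_ifs <;> rfl

theorem succMax_mem_Icc (hf : ∀ h x a, f h x a ∈ Set.Icc (0 : ℝ) 1) (h : Fin H) (y : X) :
    succMax f h y ∈ Set.Icc (0 : ℝ) 1 := by
  unfold succMax
  split_ifs
  · exact iSup_mem_Icc fun a => hf _ _ a
  · simp

theorem abs_succMax_le (hf : ∀ h x a, f h x a ∈ Set.Icc (0 : ℝ) 1) (h : Fin H) (y : X) :
    |succMax f h y| ≤ 1 :=
  abs_le.2 ⟨by linarith [(succMax_mem_Icc hf h y).1], (succMax_mem_Icc hf h y).2⟩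

theorem abs_residual_le (hf : ∀ h x a, f h x a ∈ Set.Icc (0 : ℝ) 1) (h : Fin H)
    (τ : Traj X A H) : |residual f h τ| ≤ 2 := by
  have h1 := hf h (τ h).1 (τ h).2.1
  have h2 := (τ h).2.2.2
  have h3 : nextMax f h τ ∈ Set.Icc (0 : ℝ) 1 := by
    unfold nextMax
    split_ifs
    · exact iSup_mem_Icc fun a => hf _ _ a
    · simp
  unfold residual
  exact abs_le.2 ⟨by linarith [h1.1, h2.2, h3.2], by linarith [h1.2, h2.1, h3.1]⟩

/-- Along a trajectory that plays greedily with respect to `f`, the residuals telescope. -/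
theorem sum_residual_eq [NeZero H] {p : Fin H → X → A} (hp : ∀ h x a, f h x a ≤ f h x (p h x))
    {τ : Traj X A H} (hτ : ∀ h, (τ h).2.1 = p h (τ h).1) :
    ∑ h, residual f h τ = f 0 (τ 0).1 (p 0 (τ 0).1) - totalReward τ := by
  -- `u k` is the value of `f` at layer `k`, extended by zero beyond the horizon
  let u : ℕ → ℝ := fun k => if hk : k < H then f ⟨k, hk⟩ (τ ⟨k, hk⟩).1 (p ⟨k, hk⟩ (τ ⟨k, hk⟩).1)
    else 0
  have h1 : ∀ h : Fin H, residual f h τ = (u h - u (h + 1)) - ((τ h).2.2 : ℝ) := by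
    intro h
    have hn : nextMax f h τ = u (h + 1) := by
      simp only [nextMax, u]
      split_ifs with hh
      · exact iSup_eq_of_forall_le fun a => hp _ _ a
      · rfl
    have hu : u h = f h (τ h).1 (τ h).2.1 := by simp [u, hτ h]
    rw [residual, hn, hu]
    ring
  have h2 : ∑ h : Fin H, (u h - u (h + 1)) = u 0 - u H := by
    rw [Fin.sum_univ_eq_sum_range (fun k => u k - u (k + 1)) H, Finset.sum_range_sub']
  simp_rw [h1]
  rw [Finset.sum_sub_distrib, h2, totalReward]
  have hu0 : u 0 = f 0 (τ 0).1 (p 0 (τ 0).1) := by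
    simp only [u, NeZero.pos H, dif_pos]
    rfl
  have huH : u H = 0 := by simp [u]
  rw [hu0, huH, sub_zero]

theorem abs_totalReward_le {n : ℕ} (τ : Fin n → Step X A) : |totalReward τ| ≤ n := by
  unfold totalReward
  refine (Finset.abs_sum_le_sum_abs _ _).trans ?_
  refine (Finset.sum_le_card_nsmul _ _ 1 fun i _ => MDP.abs_unitInterval_le _).trans ?_
  simp

theorem totalReward_nonneg {n : ℕ} (τ : Fin n → Step X A) : 0 ≤ totalReward τ :=
  Finset.sum_nonneg fun i _ => (τ i).2.2.2.1

end

namespace MDP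

variable {X A : Type*} [Countable X] [MeasurableSpace X] [DiscreteMeasurableSpace X]
  [Countable A] [MeasurableSpace A] [DiscreteMeasurableSpace A] {H : ℕ} {f : ValueFn X A H}

theorem measurable_residual (f : ValueFn X A H) (h : Fin H) :
    Measurable fun τ : Traj X A H => residual f h τ := by
  unfold residual
  simp_rw [nextMax_eq_nextVal]
  exact ((measurable_stateAction (f h) h).sub (measurable_reward h)).sub (measurable_nextVal _ h)

theorem measurable_totalReward {n : ℕ} :
    Measurable fun τ : Fin n → Step X A => totalReward τ := by
  unfold totalReward
  fun_prop

theorem bellmanError_eq (M : MDP X A H) (f : ValueFn X A H) (h : Fin H) (x : X) (a : A) :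
    M.bellmanError f h x a = f h x a - (∫ r, (r : ℝ) ∂(M.R h x a : Measure unitInterval) +
      if (h : ℕ) + 1 < H then ∫ y, succMax f h y ∂(M.P h x a).toMeasure else 0) := by
  unfold bellmanError succMax
  split_ifs <;> ring

theorem abs_bellmanError_le (M : MDP X A H) (hf : ∀ h x a, f h x a ∈ Set.Icc (0 : ℝ) 1)
    (h : Fin H) (x : X) (a : A) : |M.bellmanError f h x a| ≤ 2 := by
  have h1 := hf h x a
  have h2 : ∫ r, (r : ℝ) ∂(M.R h x a : Measure unitInterval) ∈ Set.Icc (0 : ℝ) 1 :=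
    ⟨integral_nonneg fun r => r.2.1,
      (le_abs_self _).trans (abs_integral_le_of_bounded abs_unitInterval_le)⟩
  have h3 : (if (h : ℕ) + 1 < H then ∫ y, succMax f h y ∂(M.P h x a).toMeasure else 0) ∈
      Set.Icc (0 : ℝ) 1 := by
    split_ifs
    · exact ⟨integral_nonneg fun y => (succMax_mem_Icc hf h y).1,
        (le_abs_self _).trans (abs_integral_le_of_bounded (abs_succMax_le hf h))⟩
    · simp
  rw [bellmanError_eq]
  exact abs_le.2 ⟨by linarith [h1.1, h2.2, h3.2], by linarith [h1.2, h2.1, h3.1]⟩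

/-- The residual has conditional mean equal to the Bellman error, given state and action. -/
theorem integral_residual_mul (M : MDP X A H) (π : Policy X A H)
    (hf : ∀ h x a, f h x a ∈ Set.Icc (0 : ℝ) 1) (h : Fin H) {G : X → A → ℝ} {Cg : ℝ}
    (hG : ∀ x a, |G x a| ≤ Cg) :
    ∫ τ, residual f h τ * G (τ h).1 (τ h).2.1 ∂(M.trajLaw π) =
      ∫ τ, M.bellmanError f h (τ h).1 (τ h).2.1 * G (τ h).1 (τ h).2.1 ∂(M.trajLaw π) := by
  set m : X → A → ℝ := fun x a => ∫ r, (r : ℝ) ∂(M.R h x a : Measure unitInterval) +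
      if (h : ℕ) + 1 < H then ∫ y, succMax f h y ∂(M.P h x a).toMeasure else 0 with hm
  have ht := integral_trajLaw_tower M π hG (abs_succMax_le hf h) h m (fun x a => rfl)
  have hGf : ∀ τ : Traj X A H, |G (τ h).1 (τ h).2.1 * f h (τ h).1 (τ h).2.1| ≤ Cg * 1 := fun τ => by
    rw [abs_mul]
    exact mul_le_mul (hG _ _) (abs_le.2 ⟨by linarith [(hf h (τ h).1 (τ h).2.1).1],
      (hf h (τ h).1 (τ h).2.1).2⟩) (abs_nonneg _) ((abs_nonneg _).trans (hG (τ h).1 (τ h).2.1))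
  have i1 : Integrable (fun τ : Traj X A H => G (τ h).1 (τ h).2.1 * f h (τ h).1 (τ h).2.1)
      (M.trajLaw π) :=
    integrable_of_bounded (measurable_stateAction (fun x a => G x a * f h x a) h) hGf
  have i2 : Integrable (fun τ : Traj X A H =>
      G (τ h).1 (τ h).2.1 * ((τ h).2.2 + nextVal (succMax f h) τ h)) (M.trajLaw π) := by
    refine integrable_of_bounded (C := Cg * (1 + 1)) ((measurable_stateAction G h).mul
      ((measurable_reward h).add (measurable_nextVal _ h))) fun τ => ?_
    rw [abs_mul]
    exact mul_le_mul (hG _ _) ((abs_add_le _ _).trans (add_le_add (abs_unitInterval_le _)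
      (abs_nextVal_le (abs_succMax_le hf h) τ h))) (abs_nonneg _)
      ((abs_nonneg _).trans (hG (τ h).1 (τ h).2.1))
  have i3 : Integrable (fun τ : Traj X A H => G (τ h).1 (τ h).2.1 * m (τ h).1 (τ h).2.1)
      (M.trajLaw π) := by
    refine integrable_of_bounded (C := Cg * 3)
      (measurable_stateAction (fun x a => G x a * m x a) h) fun τ => ?_
    rw [abs_mul]
    refine mul_le_mul (hG _ _) ?_ (abs_nonneg _) ((abs_nonneg _).trans (hG (τ h).1 (τ h).2.1))
    have h1 := abs_bellmanError_le M hf h (τ h).1 (τ h).2.1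
    have h2 := hf h (τ h).1 (τ h).2.1
    rw [bellmanError_eq, abs_le] at h1
    simp only [hm]
    exact abs_le.2 ⟨by linarith [h1.2, h2.1], by linarith [h1.1, h2.2]⟩
  calc ∫ τ, residual f h τ * G (τ h).1 (τ h).2.1 ∂(M.trajLaw π)
      = ∫ τ, (G (τ h).1 (τ h).2.1 * f h (τ h).1 (τ h).2.1 -
          G (τ h).1 (τ h).2.1 * ((τ h).2.2 + nextVal (succMax f h) τ h)) ∂(M.trajLaw π) := by
        refine integral_congr_ae (Filter.Eventually.of_forall fun τ => ?_)
        simp only [residual, nextMax_eq_nextVal]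
        ring
    _ = ∫ τ, (G (τ h).1 (τ h).2.1 * f h (τ h).1 (τ h).2.1 -
          G (τ h).1 (τ h).2.1 * m (τ h).1 (τ h).2.1) ∂(M.trajLaw π) := by
        rw [integral_sub i1 i2, integral_sub i1 i3, ht]
    _ = _ := by
        refine integral_congr_ae (Filter.Eventually.of_forall fun τ => ?_)
        simp only [bellmanError_eq, hm]
        ring

/-- Performance difference: if `p` is greedy with respect to `f`, then `f` overestimates the value
of `p` by the sum of the Bellman errors along the trajectories of `p`. -/
theorem integral_sub_J_eq [NeZero H] (M : MDP X A H) (hf : ∀ h x a, f h x a ∈ Set.Icc (0 : ℝ) 1)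
    {p : Fin H → X → A} (hp : ∀ h x a, f h x a ≤ f h x (p h x)) :
    ∫ x, f 0 x (p 0 x) ∂M.d₁.toMeasure - M.J (detPolicy p) =
      ∑ h, ∫ τ, M.bellmanError f h (τ h).1 (τ h).2.1 ∂(M.trajLaw (detPolicy p)) := by
  have hfb : ∀ x, |f 0 x (p 0 x)| ≤ 1 := fun x =>
    abs_le.2 ⟨by linarith [(hf 0 x (p 0 x)).1], (hf 0 x (p 0 x)).2⟩
  have hres : ∀ h, ∫ τ, M.bellmanError f h (τ h).1 (τ h).2.1 ∂(M.trajLaw (detPolicy p)) =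
      ∫ τ, residual f h τ ∂(M.trajLaw (detPolicy p)) := fun h => by
    simpa using (integral_residual_mul M (detPolicy p) hf h (G := fun _ _ => 1) (Cg := 1)
      (by simp)).symm
  simp_rw [hres]
  rw [← integral_finsetSum _ fun h _ =>
    integrable_of_bounded (measurable_residual f h) (abs_residual_le hf h)]
  rw [← integral_trajLaw_zero_fst M (detPolicy p) (φ := fun x => f 0 x (p 0 x)) hfb, J,
    ← integral_sub]
  · refine integral_congr_ae ?_
    filter_upwards [ae_trajLaw_action M p] with τ hτ
    exact (sum_residual_eq hp hτ).symm
  · exact integrable_of_bounded ((Measurable.of_discrete (f := fun x => f 0 x (p 0 x))).comp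
      (by fun_prop : Measurable fun τ : Traj X A H => (τ 0).1)) fun τ => hfb _
  · exact integrable_of_bounded measurable_totalReward abs_totalReward_le

/-! ### Occupancy measures -/

/-- The occupancy `d_h^π` as a measure on state-action pairs. -/
noncomputable def occMeasure (M : MDP X A H) (π : Policy X A H) (h : Fin H) : Measure (X × A) :=
  (M.trajLaw π).map fun τ => ((τ h).1, (τ h).2.1)

theorem measurable_stateActionPair (h : Fin H) :
    Measurable fun τ : Traj X A H => ((τ h).1, (τ h).2.1) := by fun_prop

instance isProbabilityMeasure_occMeasure (M : MDP X A H) (π : Policy X A H) (h : Fin H) :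
    IsProbabilityMeasure (M.occMeasure π h) :=
  Measure.isProbabilityMeasure_map (measurable_stateActionPair h).aemeasurable

theorem occMeasure_singleton (M : MDP X A H) (π : Policy X A H) (h : Fin H) (z : X × A) :
    M.occMeasure π h {z} = M.occ π h z.1 z.2 := by
  rw [occMeasure, Measure.map_apply (measurable_stateActionPair h) (measurableSet_singleton z), occ]
  congr 1
  ext τ
  simp [Prod.ext_iff]

/-- The occupancy `d_h^π(x,a)` as a real number. -/
noncomputable def occReal (M : MDP X A H) (π : Policy X A H) (h : Fin H) (z : X × A) : ℝ :=
  (M.occ π h z.1 z.2).toReal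

theorem occReal_nonneg (M : MDP X A H) (π : Policy X A H) (h : Fin H) (z : X × A) :
    0 ≤ M.occReal π h z := ENNReal.toReal_nonneg

theorem occ_ne_top (M : MDP X A H) (π : Policy X A H) (h : Fin H) (x : X) (a : A) :
    M.occ π h x a ≠ ∞ := measure_ne_top _ _

/-- Expectations of functions of `(x_h, a_h)` are sums against the occupancy. -/
theorem hasSum_occReal_mul (M : MDP X A H) (π : Policy X A H) (h : Fin H) {G : X × A → ℝ} {C : ℝ}
    (hG : ∀ z, |G z| ≤ C) :
    HasSum (fun z => M.occReal π h z * G z) (∫ τ, G ((τ h).1, (τ h).2.1) ∂(M.trajLaw π)) := by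
  have hi : Integrable G (M.occMeasure π h) := integrable_of_bounded Measurable.of_discrete hG
  have hs : ∫ τ, G ((τ h).1, (τ h).2.1) ∂(M.trajLaw π) = ∫ z, G z ∂(M.occMeasure π h) := by
    rw [occMeasure, integral_map (measurable_stateActionPair h).aemeasurable
      Measurable.of_discrete.aestronglyMeasurable]
  rw [hs, ← setIntegral_univ, ← Set.iUnion_of_singleton]
  have := hasSum_integral_iUnion (f := G) (μ := M.occMeasure π h)
    (s := fun z : X × A => {z}) (fun z => measurableSet_singleton z)
    (fun z w hzw => by simpa using hzw) hi.integrableOn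
  simpa [occMeasure_singleton, occReal, measureReal_def] using this

theorem hasSum_occReal (M : MDP X A H) (π : Policy X A H) (h : Fin H) :
    HasSum (M.occReal π h) 1 := by
  simpa using hasSum_occReal_mul M π h (G := fun _ => 1) (C := 1) (by simp)

theorem tsum_occ (M : MDP X A H) (π : Policy X A H) (h : Fin H) :
    ∑' z : X × A, M.occ π h z.1 z.2 = 1 := by
  simp_rw [← occMeasure_singleton]
  have := lintegral_countable' (μ := M.occMeasure π h) fun _ => 1
  simpa using this.symm

end MDP

namespace MDP

variable {X A : Type*} [Countable X] [MeasurableSpace X] [DiscreteMeasurableSpace X]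
  [Countable A] [MeasurableSpace A] [DiscreteMeasurableSpace A] {H : ℕ}

/-! ### Optimality of `Q^⋆` -/

/-- The last `n` steps depend on the policy at the last `n` layers only. -/
theorem rollout_congr (M : MDP X A H) {π π' : Policy X A H} (n : ℕ) (hn : n ≤ H)
    (h : ∀ k : Fin H, H - n ≤ k → π k = π' k) (x : X) :
    M.rollout π n hn x = M.rollout π' n hn x := by
  induction n generalizing x with
  | zero => rfl
  | succ n ih =>
    have : M.rollout π n (by omega) = M.rollout π' n (by omega) :=
      funext fun y => ih (by omega) (fun k hk => h k (by omega)) y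
    rw [rollout, rollout, this, h ⟨H - (n + 1), by omega⟩ le_rfl]

theorem V_eq_integral_rollout (M : MDP X A H) (π : Policy X A H) (h : Fin H) (x : X) (n : ℕ)
    (hn : n ≤ H) (hh : H - (h : ℕ) = n) :
    M.V π h x = ∫ τ, totalReward τ ∂(M.rollout π n hn x) := by
  subst hh
  rfl

theorem V_eq_integral_Q (M : MDP X A H) (π : Policy X A H) (h : Fin H) (x : X) :
    M.V π h x = ∫ a, M.Q π h x a ∂(π h x).toMeasure := by
  have hh := h.isLt
  rw [V_eq_integral_rollout M π h x (H - (h + 1) + 1) (by omega) (by omega),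
    integral_rollout_succ M π _ _ x measurable_totalReward abs_totalReward_le]
  have : (⟨H - (H - (h + 1) + 1), by omega⟩ : Fin H) = h := Fin.ext (by simp only; omega)
  rw [this]
  rfl

theorem V_detPolicy (M : MDP X A H) (p : Fin H → X → A) (h : Fin H) (x : X) :
    M.V (detPolicy p) h x = M.Q (detPolicy p) h x (p h x) := by
  rw [V_eq_integral_Q, detPolicy, PMF.toMeasure_pure, integral_dirac]

/-- Bellman equation for `Q^π`. -/
theorem Q_eq (M : MDP X A H) (π : Policy X A H) (h : Fin H) (x : X) (a : A) :
    M.Q π h x a = ∫ r, (r : ℝ) ∂(M.R h x a : Measure unitInterval) +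
      if hh : (h : ℕ) + 1 < H then ∫ y, M.V π ⟨h + 1, hh⟩ y ∂(M.P h x a).toMeasure else 0 := by
  have hH := h.isLt
  have hri : Integrable (fun r : unitInterval => (r : ℝ)) (M.R h x a : Measure unitInterval) :=
    integrable_of_bounded (by fun_prop) abs_unitInterval_le
  have key : ∀ y, ∫ τ, totalReward τ ∂(M.rollout π (H - (h + 1)) (by omega) y) =
      if hh : (h : ℕ) + 1 < H then M.V π ⟨h + 1, hh⟩ y else 0 := fun y => by
    split_ifs with hh
    · rfl
    · have h0 : H - ((h : ℕ) + 1) = 0 := by omega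
      have hz : ∀ τ : Fin (H - (h + 1)) → Step X A, totalReward τ = 0 := fun τ =>
        Finset.sum_eq_zero fun i _ => absurd i.isLt (by omega)
      simp [hz]
  have hb : ∀ y, |∫ τ, totalReward τ ∂(M.rollout π (H - (h + 1)) (by omega) y)| ≤
      ((H - (h + 1) : ℕ) : ℝ) := fun y => abs_integral_le_of_bounded abs_totalReward_le
  have hyi : Integrable (fun y => ∫ τ, totalReward τ ∂(M.rollout π (H - (h + 1)) (by omega) y))
      (M.P h x a).toMeasure := integrable_of_bounded Measurable.of_discrete hb
  rw [Q, integral_stepLaw M h (fun _ => inferInstance) x a measurable_totalReward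
    abs_totalReward_le]
  have inner : ∀ (r : unitInterval) (y : X), ∫ σ, totalReward
      (Fin.cons (α := fun _ => Step X A) (x, a, r) σ : Fin (H - (h + 1) + 1) → Step X A)
        ∂(M.rollout π (H - (h + 1)) (by omega) y) =
      (r : ℝ) + ∫ τ, totalReward τ ∂(M.rollout π (H - (h + 1)) (by omega) y) := fun r y => by
    have : ∀ σ : Fin (H - (h + 1)) → Step X A, totalReward
        (Fin.cons (α := fun _ => Step X A) (x, a, r) σ : Fin (H - (h + 1) + 1) → Step X A) =
        (r : ℝ) + totalReward σ := fun σ => by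
      simp [totalReward, Fin.sum_univ_succ]
    simp_rw [this]
    rw [integral_add (integrable_const _)
      (integrable_of_bounded measurable_totalReward abs_totalReward_le), integral_const,
      probReal_univ, one_smul]
  simp_rw [inner, integral_add (integrable_const _) hyi, integral_const, probReal_univ, one_smul]
  rw [integral_add hri (integrable_const _), integral_const, probReal_univ, one_smul]
  simp_rw [key]
  split_ifs <;> simp

theorem IsOptimal.Q_le (M : MDP X A H) {p : Fin H → X → A} (hp : M.IsOptimal p) (h : Fin H)
    (x : X) (a : A) : M.Q (detPolicy p) h x a ≤ M.Q (detPolicy p) h x (p h x) := by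
  -- deviate from `p` to the action `a` at layer `h` only
  have hq : M.V (detPolicy (Function.update p h fun _ => a)) h x = M.Q (detPolicy p) h x a := by
    rw [V_detPolicy, Function.update_self, Q, Q]
    congr 2
    ext1 y
    refine rollout_congr M _ _ (fun k hk => ?_) y
    have hkh : k ≠ h := by
      rintro rfl
      have := k.isLt
      omega
    funext z
    simp [detPolicy, Function.update_of_ne hkh]
  rw [← hq, ← V_detPolicy]
  exact hp _ h x

/-- Bellman optimality equation: `Q^⋆` has no Bellman error. -/
theorem IsOptimal.bellmanError_Q (M : MDP X A H) {p : Fin H → X → A} (hp : M.IsOptimal p)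
    (h : Fin H) (x : X) (a : A) : M.bellmanError (M.Q (detPolicy p)) h x a = 0 := by
  have key : ∀ h y, ⨆ a', M.Q (detPolicy p) h y a' = M.V (detPolicy p) h y := fun h y => by
    rw [iSup_eq_of_forall_le (hp.Q_le M h y), V_detPolicy]
  rw [bellmanError]
  simp_rw [key]
  rw [Q_eq]
  split_ifs <;> ring

/-- The optimal value is the mean of `Q_1^⋆` at the optimal initial action: the gap in the
performance difference identity consists of Bellman errors of `Q^⋆`. -/
theorem IsOptimal.J_eq [NeZero H] (M : MDP X A H) {p : Fin H → X → A} (hp : M.IsOptimal p)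
    (hQ : ∀ h x a, M.Q (detPolicy p) h x a ∈ Set.Icc (0 : ℝ) 1) :
    M.J (detPolicy p) = ∫ x, M.Q (detPolicy p) 0 x (p 0 x) ∂M.d₁.toMeasure := by
  have := integral_sub_J_eq M hQ (hp.Q_le M)
  simp only [hp.bellmanError_Q M, integral_zero, Finset.sum_const_zero] at this
  linarith

end MDP

/-! ### Concentration for adaptively collected data -/

/-- A map with finitely many values and measurable level sets. The codomain needs no measurable
structure, and composing with an arbitrary function gives a measurable map. -/
structure IsFiniteRule {α β : Type*} [MeasurableSpace α] (g : α → β) : Prop where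
  finite : (Set.range g).Finite
  measurableSet : ∀ b, MeasurableSet {a | g a = b}

theorem IsFiniteRule.measurable_comp {α β γ : Type*} [MeasurableSpace α] [MeasurableSpace γ]
    {g : α → β} (hg : IsFiniteRule g) (Ψ : β → γ) : Measurable fun a => Ψ (g a) := by
  intro S _
  have : (fun a => Ψ (g a)) ⁻¹' S = ⋃ b ∈ Set.range g ∩ Ψ ⁻¹' S, {a | g a = b} := by
    ext a
    simp
  rw [this]
  exact (hg.finite.subset Set.inter_subset_left).measurableSet_biUnion
    fun b _ => hg.measurableSet b

theorem IsFiniteRule.comp {α β γ : Type*} [MeasurableSpace α] {g : α → β} (hg : IsFiniteRule g)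
    (Ψ : β → γ) : IsFiniteRule fun a => Ψ (g a) where
  finite := by
    have : Set.range (fun a => Ψ (g a)) = Ψ '' Set.range g := Set.range_comp Ψ g
    rw [this]
    exact hg.finite.image Ψ
  measurableSet c := by
    -- with the discrete structure on `γ` singletons are measurable, whatever `γ` is
    let _ : MeasurableSpace γ := ⊤
    exact (hg.measurable_comp Ψ) (MeasurableSpace.measurableSet_top (s := {c}))

/-- The data of the first `s` of `T` rounds. -/
def dataPrefix {X A : Type*} {H K s T : ℕ} (h : s ≤ T) (D : Dataset X A H K T) :
    Dataset X A H K s :=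
  fun i => D (Fin.castLE h i)

section

variable {X A : Type*} [Countable X] [MeasurableSpace X] [DiscreteMeasurableSpace X]
  [Countable A] [MeasurableSpace A] [DiscreteMeasurableSpace A] {H K : ℕ}

theorem measurable_dataPrefix {s T : ℕ} (h : s ≤ T) :
    Measurable (dataPrefix (X := X) (A := A) (H := H) (K := K) h) :=
  measurable_pi_iff.2 fun _ => measurable_pi_apply _

theorem measurable_snoc_pair (s : ℕ) : Measurable
    fun p : Dataset X A H K s × (Fin K → Traj X A H) =>
      (Fin.snoc (α := fun _ => Fin K → Traj X A H) p.1 p.2 : Dataset X A H K (s + 1)) := by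
  refine measurable_pi_iff.2 fun i => ?_
  refine Fin.lastCases ?_ (fun j => ?_) i
  · simp only [Fin.snoc_last]; exact measurable_snd
  · simp only [Fin.snoc_castSucc]; exact (measurable_pi_apply j).comp measurable_fst

theorem measurable_snoc (s : ℕ) (D : Dataset X A H K s) : Measurable
    fun τs : Fin K → Traj X A H =>
      (Fin.snoc (α := fun _ => Fin K → Traj X A H) D τs : Dataset X A H K (s + 1)) :=
  (measurable_snoc_pair s).comp measurable_prodMk_left

variable {M : MDP X A H} {pol : (s : ℕ) → Dataset X A H K s → Policy X A H}

/-- The law of the data after one more round depends measurably on the data before it. Without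
this the `bind` in `dataLaw` would take a junk value. -/
theorem measurable_roundLaw (M : MDP X A H) {s : ℕ} (hpol : IsFiniteRule (pol s)) :
    Measurable fun D : Dataset X A H K s =>
      (Measure.pi fun _ : Fin K => M.trajLaw (pol s D)).map
        fun τs => (Fin.snoc (α := fun _ => Fin K → Traj X A H) D τs : Dataset X A H K (s + 1)) := by
  have hκ : Measurable fun D : Dataset X A H K s =>
      Measure.pi fun _ : Fin K => M.trajLaw (pol s D) :=
    hpol.measurable_comp fun π => Measure.pi fun _ : Fin K => M.trajLaw π
  let κ : ProbabilityTheory.Kernel (Dataset X A H K s) (Fin K → Traj X A H) := ⟨_, hκ⟩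
  have : ProbabilityTheory.IsMarkovKernel κ :=
    ⟨fun D => (inferInstance : IsProbabilityMeasure
      (Measure.pi fun _ : Fin K => M.trajLaw (pol s D)))⟩
  refine Measure.measurable_of_measurable_coe _ fun S hS => ?_
  simp_rw [Measure.map_apply (measurable_snoc s _) hS]
  exact ProbabilityTheory.Kernel.measurable_kernel_prodMk_left (κ := κ)
    (measurable_snoc_pair s hS)

theorem isProbabilityMeasure_dataLaw (hpol : ∀ s, IsFiniteRule (pol s)) (s : ℕ) :
    IsProbabilityMeasure (dataLaw M K pol s) := by
  induction s with
  | zero => rw [dataLaw]; infer_instance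
  | succ s ih =>
    rw [dataLaw]
    exact isProbabilityMeasure_bind (measurable_roundLaw M (hpol s)).aemeasurable
      (Filter.Eventually.of_forall fun D =>
        Measure.isProbabilityMeasure_map (measurable_snoc s D).aemeasurable)

theorem lintegral_dataLaw_succ (hpol : ∀ s, IsFiniteRule (pol s)) (s : ℕ)
    {φ : Dataset X A H K (s + 1) → ℝ≥0∞} (hφ : Measurable φ) :
    ∫⁻ D, φ D ∂(dataLaw M K pol (s + 1)) =
      ∫⁻ D, ∫⁻ τs, φ (Fin.snoc (α := fun _ => Fin K → Traj X A H) D τs)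
        ∂(Measure.pi fun _ : Fin K => M.trajLaw (pol s D)) ∂(dataLaw M K pol s) := by
  rw [dataLaw, Measure.lintegral_bind (measurable_roundLaw M (hpol s)).aemeasurable
    hφ.aemeasurable]
  exact lintegral_congr fun D => lintegral_map hφ (measurable_snoc s D)

theorem dataPrefix_snoc {s T : ℕ} (h : s ≤ T) (D : Dataset X A H K T) (τs : Fin K → Traj X A H) :
    dataPrefix (h.trans T.le_succ)
      (Fin.snoc (α := fun _ => Fin K → Traj X A H) D τs : Dataset X A H K (T + 1)) =
      dataPrefix h D := by
  funext i
  exact Fin.snoc_castSucc (α := fun _ => Fin K → Traj X A H) τs D (Fin.castLE h i)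

/-- The first `s` rounds of a longer run are distributed as a run of `s` rounds. -/
theorem lintegral_dataPrefix (hpol : ∀ s, IsFiniteRule (pol s)) {s T : ℕ} (h : s ≤ T)
    {φ : Dataset X A H K s → ℝ≥0∞} (hφ : Measurable φ) :
    ∫⁻ D, φ (dataPrefix h D) ∂(dataLaw M K pol T) = ∫⁻ D, φ D ∂(dataLaw M K pol s) := by
  induction T, h using Nat.le_induction with
  | base => rfl
  | succ T h ih =>
    rw [lintegral_dataLaw_succ (φ := fun D => φ (dataPrefix _ D)) hpol T
      (hφ.comp (measurable_dataPrefix _)), ← ih]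
    refine lintegral_congr fun D => ?_
    simp_rw [dataPrefix_snoc h D]
    simp

/-- The accumulated excess of `g` over its per-round compensator `K * ψ(π)`. -/
noncomputable def excess (pol : (s : ℕ) → Dataset X A H K s → Policy X A H) (g : Traj X A H → ℝ)
    (ψ : Policy X A H → ℝ) {s : ℕ} (D : Dataset X A H K s) : ℝ :=
  ∑ i : Fin s, ((∑ k, g (D i k)) - K * ψ (pol i (dataPrefix i.isLt.le D)))

theorem excess_snoc (g : Traj X A H → ℝ) (ψ : Policy X A H → ℝ) {s : ℕ} (D : Dataset X A H K s)
    (τs : Fin K → Traj X A H) :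
    excess pol g ψ
      (Fin.snoc (α := fun _ => Fin K → Traj X A H) D τs : Dataset X A H K (s + 1)) =
      excess pol g ψ D + ((∑ k, g (τs k)) - K * ψ (pol s D)) := by
  unfold excess
  rw [Fin.sum_univ_castSucc]
  congr 1
  · refine Finset.sum_congr rfl fun i _ => ?_
    have := dataPrefix_snoc i.isLt.le D τs
    simp only [Fin.snoc_castSucc, Fin.val_castSucc]
    rw [this]
  · have := dataPrefix_snoc le_rfl D τs
    simp only [Fin.snoc_last, Fin.val_last]
    rw [this]
    rfl

theorem measurable_excess (hpol : ∀ s, IsFiniteRule (pol s)) {g : Traj X A H → ℝ}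
    (hg : Measurable g) (ψ : Policy X A H → ℝ) (s : ℕ) :
    Measurable fun D : Dataset X A H K s => excess pol g ψ D := by
  refine Finset.measurable_sum _ fun i _ => Measurable.sub ?_ (measurable_const.mul ?_)
  · refine Finset.measurable_sum _ fun k _ => hg.comp ?_
    exact (measurable_pi_apply k).comp (measurable_pi_apply i)
  · exact ((hpol i).measurable_comp ψ).comp (measurable_dataPrefix i.isLt.le)

/-- An elementary bound on moment generating functions, from `exp u ≤ 1 + u + u ^ 2`. -/
theorem integral_exp_le {α : Type*} [MeasurableSpace α] {μ : Measure α} [IsProbabilityMeasure μ]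
    {g : α → ℝ} (hg : Measurable g) (hb : ∀ a, |g a| ≤ 1) :
    ∫ a, Real.exp (g a) ∂μ ≤ Real.exp (∫ a, g a ∂μ + ∫ a, g a ^ 2 ∂μ) := by
  have i1 : Integrable g μ := integrable_of_bounded hg hb
  have i2 : Integrable (fun a => g a ^ 2) μ :=
    integrable_of_bounded (C := 1) (hg.pow_const 2) fun a => by
      rw [abs_pow]; exact pow_le_one₀ (abs_nonneg _) (hb a)
  have h : ∀ a, Real.exp (g a) ≤ 1 + g a + g a ^ 2 := fun a => by
    have := (abs_le.1 (Real.abs_exp_sub_one_sub_id_le (hb a))).2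
    linarith
  calc ∫ a, Real.exp (g a) ∂μ ≤ ∫ a, (1 + g a + g a ^ 2) ∂μ :=
        integral_mono_of_nonneg (Filter.Eventually.of_forall fun a => (Real.exp_pos _).le)
          (((integrable_const 1).add i1).add i2) (Filter.Eventually.of_forall h)
    _ = 1 + ∫ a, g a ∂μ + ∫ a, g a ^ 2 ∂μ := by
        rw [integral_add (f := fun a => 1 + g a) ((integrable_const 1).add i1) i2,
          integral_add (integrable_const 1) i1]
        simp
    _ ≤ _ := by
        have := Real.add_one_le_exp (∫ a, g a ∂μ + ∫ a, g a ^ 2 ∂μ)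
        linarith

/-- The compensator of `g` per trajectory: its first plus its second moment. -/
noncomputable def compensator (M : MDP X A H) (g : Traj X A H → ℝ) (π : Policy X A H) : ℝ :=
  ∫ τ, g τ ∂(M.trajLaw π) + ∫ τ, g τ ^ 2 ∂(M.trajLaw π)

theorem lintegral_exp_sum_le (M : MDP X A H) (π : Policy X A H) {g : Traj X A H → ℝ}
    (hg : Measurable g) (hb : ∀ τ, |g τ| ≤ 1) (K : ℕ) :
    ∫⁻ τs, ENNReal.ofReal (Real.exp (∑ k, g (τs k)))
        ∂(Measure.pi fun _ : Fin K => M.trajLaw π) ≤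
      ENNReal.ofReal (Real.exp (K * compensator M g π)) := by
  have hsum : ∀ τs : Fin K → Traj X A H, |∑ k, g (τs k)| ≤ K := fun τs => by
    refine (Finset.abs_sum_le_sum_abs _ _).trans ?_
    refine (Finset.sum_le_card_nsmul _ _ 1 fun i _ => hb _).trans ?_
    simp
  have hm : Measurable fun τs : Fin K → Traj X A H => Real.exp (∑ k, g (τs k)) :=
    Real.measurable_exp.comp
      (Finset.measurable_sum _ fun k _ => hg.comp (measurable_pi_apply k))
  have hi : Integrable (fun τs : Fin K → Traj X A H => Real.exp (∑ k, g (τs k)))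
      (Measure.pi fun _ : Fin K => M.trajLaw π) :=
    integrable_of_bounded (C := Real.exp K) hm fun τs => by
      rw [abs_of_pos (Real.exp_pos _)]
      exact Real.exp_le_exp.2 ((le_abs_self _).trans (hsum τs))
  rw [← ofReal_integral_eq_lintegral_ofReal hi
    (Filter.Eventually.of_forall fun _ => (Real.exp_pos _).le)]
  refine ENNReal.ofReal_le_ofReal ?_
  simp_rw [Real.exp_sum]
  rw [integral_fintype_prod_eq_pow (fun τ => Real.exp (g τ)), Fintype.card_fin, Real.exp_nat_mul]
  exact pow_le_pow_left₀ (integral_nonneg fun _ => (Real.exp_pos _).le)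
    (integral_exp_le hg hb) K

/-- The exponential of the excess is a supermartingale, so its mean is at most `1`. -/
theorem lintegral_exp_excess_le (hpol : ∀ s, IsFiniteRule (pol s)) {g : Traj X A H → ℝ}
    (hg : Measurable g) (hb : ∀ τ, |g τ| ≤ 1) (s : ℕ) :
    ∫⁻ D, ENNReal.ofReal (Real.exp (excess pol g (compensator M g) D))
      ∂(dataLaw M K pol s) ≤ 1 := by
  induction s with
  | zero =>
    have := isProbabilityMeasure_dataLaw (M := M) hpol 0
    simp [excess]
  | succ s ih =>
    have hm : ∀ s, Measurable fun D : Dataset X A H K s =>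
        ENNReal.ofReal (Real.exp (excess pol g (compensator M g) D)) := fun s =>
      (Real.measurable_exp.comp (measurable_excess hpol hg _ s)).ennreal_ofReal
    rw [lintegral_dataLaw_succ hpol s (hm _)]
    refine (lintegral_mono fun D => ?_).trans ih
    have h1 : ∀ τs : Fin K → Traj X A H, ENNReal.ofReal (Real.exp (excess pol g (compensator M g)
        (Fin.snoc (α := fun _ => Fin K → Traj X A H) D τs : Dataset X A H K (s + 1)))) =
        ENNReal.ofReal (Real.exp (excess pol g (compensator M g) D -
          K * compensator M g (pol s D))) * ENNReal.ofReal (Real.exp (∑ k, g (τs k))) := by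
      intro τs
      rw [← ENNReal.ofReal_mul (Real.exp_pos _).le, ← Real.exp_add, excess_snoc]
      congr 2
      ring
    simp_rw [h1]
    rw [lintegral_const_mul' _ _ ENNReal.ofReal_ne_top]
    refine (mul_le_mul_right (lintegral_exp_sum_le M (pol s D) hg hb K) _).trans ?_
    rw [← ENNReal.ofReal_mul (Real.exp_pos _).le, ← Real.exp_add, sub_add_cancel]

/-- Freedman-type inequality: except with probability `exp (-L)`, the sum of `g` over the
trajectories of the first `s` rounds exceeds its compensator by at most `L`. -/
theorem dataLaw_excess_gt_le (hpol : ∀ s, IsFiniteRule (pol s)) {g : Traj X A H → ℝ}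
    (hg : Measurable g) (hb : ∀ τ, |g τ| ≤ 1) {s T : ℕ} (h : s ≤ T) (L : ℝ) :
    dataLaw M K pol T {D | L < excess pol g (compensator M g) (dataPrefix h D)} ≤
      ENNReal.ofReal (Real.exp (-L)) := by
  have hm : Measurable fun D : Dataset X A H K s =>
      ENNReal.ofReal (Real.exp (excess pol g (compensator M g) D)) :=
    (Real.measurable_exp.comp (measurable_excess hpol hg _ s)).ennreal_ofReal
  have hpos : ENNReal.ofReal (Real.exp L) ≠ 0 := by simp [Real.exp_pos]
  calc dataLaw M K pol T {D | L < excess pol g (compensator M g) (dataPrefix h D)}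
      ≤ dataLaw M K pol T {D | ENNReal.ofReal (Real.exp L) ≤
          ENNReal.ofReal (Real.exp (excess pol g (compensator M g) (dataPrefix h D)))} :=
        measure_mono fun D hD => ENNReal.ofReal_le_ofReal (Real.exp_le_exp.2 (le_of_lt hD))
    _ ≤ (∫⁻ D, ENNReal.ofReal (Real.exp (excess pol g (compensator M g) (dataPrefix h D)))
          ∂(dataLaw M K pol T)) / ENNReal.ofReal (Real.exp L) :=
        meas_ge_le_lintegral_div (hm.comp (measurable_dataPrefix h)).aemeasurable hpos
          ENNReal.ofReal_ne_top
    _ ≤ 1 / ENNReal.ofReal (Real.exp L) := by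
        gcongr
        rw [lintegral_dataPrefix hpol h hm]
        exact lintegral_exp_excess_le hpol hg hb s
    _ = ENNReal.ofReal (Real.exp (-L)) := by
        rw [Real.exp_neg, ENNReal.ofReal_inv_of_pos (Real.exp_pos _), one_div]

end

/-! ### Clipped density ratios -/

theorem clip_nonneg (w : ℝ≥0∞) (c : ℝ) : 0 ≤ clip w c := ENNReal.toReal_nonneg

theorem clip_le (w : ℝ≥0∞) {c : ℝ} (hc : 0 ≤ c) : clip w c ≤ c := by
  unfold clip
  calc (min w (ENNReal.ofReal c)).toReal ≤ (ENNReal.ofReal c).toReal :=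
        ENNReal.toReal_mono ENNReal.ofReal_ne_top (min_le_right _ _)
    _ = c := ENNReal.toReal_ofReal hc

theorem clip_top {c : ℝ} (hc : 0 ≤ c) : clip ∞ c = c := by
  simp [clip, ENNReal.toReal_ofReal hc]

theorem clip_of_ne_top {w : ℝ≥0∞} (hw : w ≠ ∞) {c : ℝ} (hc : 0 ≤ c) :
    clip w c = min w.toReal c := by
  rw [clip, ENNReal.toReal_min hw ENNReal.ofReal_ne_top, ENNReal.toReal_ofReal hc]

/-- The mixture of the ratios `d_i / d` is `d / ((1/s) ∑ d_i)`; this is the corresponding statement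
for the clipped weight, multiplied out so as to hold without a case distinction on zeros. -/
theorem clip_mixture_ratio {s : ℕ} (hs : 1 ≤ s) {c : ℝ} (hc : 0 < c) (d : ℝ≥0∞) (hd : d ≠ ∞)
    (e : Fin s → ℝ≥0∞) (he : ∀ i, e i ≠ ∞) :
    clip (((∑ i, ratio (e i) d) / (s : ℝ≥0∞))⁻¹) c * ∑ i, (e i).toReal ≤ s * d.toReal ∧
    (clip (((∑ i, ratio (e i) d) / (s : ℝ≥0∞))⁻¹) c * ∑ i, (e i).toReal = s * d.toReal ∨
      clip (((∑ i, ratio (e i) d) / (s : ℝ≥0∞))⁻¹) c = c) := by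
  have hs0 : (s : ℝ≥0∞) ≠ 0 := by simp; omega
  have hst : (s : ℝ≥0∞) ≠ ∞ := ENNReal.natCast_ne_top s
  rcases eq_or_ne d 0 with rfl | hd0
  -- for `d = 0` the weight is `1` if all `e i` vanish (as `0 / 0 = 1`) and `1 / ∞ = 0` otherwise
  · by_cases hall : ∀ i, e i = 0
    · simp [hall]
    · push Not at hall
      obtain ⟨i, hi⟩ := hall
      have h1 : ∑ i, ratio (e i) 0 = ∞ := by
        refine ENNReal.sum_eq_top.2 ⟨i, Finset.mem_univ _, ?_⟩
        simp [ratio, hi, ENNReal.div_zero hi]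
      have h2 : ((∑ i, ratio (e i) 0) / (s : ℝ≥0∞))⁻¹ = 0 := by
        rw [h1, ENNReal.top_div_of_ne_top hst, ENNReal.inv_top]
      rw [h2]
      simp [clip]
  · have hr : ∑ i, ratio (e i) d = (∑ i, e i) / d := by
      simp only [ratio, hd0, and_false, if_false, div_eq_mul_inv, Finset.sum_mul]
    have hSt : ∑ i, e i ≠ ∞ := ENNReal.sum_ne_top.2 fun i _ => he i
    have hSr : ∑ i, (e i).toReal = (∑ i, e i).toReal :=
      (ENNReal.toReal_sum fun i _ => he i).symm
    rw [hr, hSr]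
    generalize hS : ∑ i, e i = S at *
    rcases eq_or_ne S 0 with rfl | hS0
    -- an unvisited pair has infinite weight, and the clipped weight is `c`
    · have : ((0 : ℝ≥0∞) / d / s)⁻¹ = ∞ := by simp
      rw [this, clip_top hc.le]
      refine ⟨by simp; positivity, Or.inr rfl⟩
    · have hSpos : 0 < S.toReal := ENNReal.toReal_pos hS0 hSt
      have hdpos : 0 < d.toReal := ENNReal.toReal_pos hd0 hd
      have hspos : (0 : ℝ) < s := by exact_mod_cast hs
      have hq0 : S / d / s ≠ 0 := by simp [ENNReal.div_eq_zero_iff, hS0, hd, hst]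
      rw [clip_of_ne_top (ENNReal.inv_ne_top.2 hq0) hc.le, ENNReal.toReal_inv, ENNReal.toReal_div,
        ENNReal.toReal_div, ENNReal.toReal_natCast]
      have hv : (S.toReal / d.toReal / s)⁻¹ * S.toReal = s * d.toReal := by
        field_simp
      refine ⟨?_, ?_⟩
      · rw [← hv]
        exact mul_le_mul_of_nonneg_right (min_le_left _ _) hSpos.le
      · rcases min_choice (S.toReal / d.toReal / (s : ℝ))⁻¹ c with h | h
        · left; rw [h, hv]
        · right; exact h

/-- Pointwise change of measure. Here `d` is the new occupancy, `S` the sum of the `s` old ones,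
and `w` the ratio `d / (S / s)` clipped at `c`. -/
theorem mul_le_clip_mul_add {s c d S w b γ : ℝ} (hs : 0 < s) (hc : 0 < c) (hd : 0 ≤ d)
    (hS : 0 ≤ S) (hγ : 0 ≤ γ) (hγc : γ * s ≤ c) (h1 : w * S ≤ s * d)
    (h2 : w * S = s * d ∨ w = c) (hb : |b| ≤ 2) :
    d * b ≤ S / s * (w * b) + 2 * (2 * d ^ 2 / (d + γ * S)) := by
  have hΦ : 0 ≤ 2 * d ^ 2 / (d + γ * S) := by positivity
  rcases h2 with h2 | rfl
  · have : S / s * (w * b) = d * b := by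
      rw [div_mul_eq_mul_div, div_eq_iff hs.ne']
      linear_combination b * h2
    linarith
  · have hle : w * S / s ≤ d := by rw [div_le_iff₀ hs]; linarith
    have h3 : d * b - S / s * (w * b) ≤ 2 * d := by
      have : d * b - S / s * (w * b) = (d - w * S / s) * b := by ring
      rw [this]
      calc (d - w * S / s) * b ≤ (d - w * S / s) * 2 :=
            mul_le_mul_of_nonneg_left ((le_abs_self b).trans hb) (by linarith)
        _ ≤ 2 * d := by have : 0 ≤ w * S / s := by positivity
                        linarith
    have h4 : d ≤ 2 * d ^ 2 / (d + γ * S) := by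
      rcases hd.eq_or_lt with rfl | hd'
      · simp
      · rw [le_div_iff₀ (by positivity)]
        have : γ * S ≤ d := by
          refine le_trans ?_ hle
          rw [le_div_iff₀ hs]
          calc γ * S * s = γ * s * S := by ring
            _ ≤ w * S := mul_le_mul_of_nonneg_right hγc hS
        nlinarith
    linarith

/-- The second moment of the clipped weight at a single pair. -/
theorem clip_sq_le {s c d S w γ : ℝ} (hs : 0 < s) (hc : 0 < c) (hd : 0 ≤ d)
    (hS : 0 ≤ S) (hγ : 0 ≤ γ) (hγc : γ * s ≤ c) (hw0 : 0 ≤ w) (hwc : w ≤ c)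
    (h1 : w * S ≤ s * d) :
    S / s * w ^ 2 / c ≤ 2 * d ^ 2 / (d + γ * S) := by
  have h2 : S / s * w ^ 2 / c ≤ d * (w / c) := by
    have : S / s * w ^ 2 / c = (w * S / s) * (w / c) := by ring
    rw [this]
    refine mul_le_mul_of_nonneg_right ?_ (by positivity)
    rw [div_le_iff₀ hs]; linarith
  refine h2.trans ?_
  rcases hd.eq_or_lt with rfl | hd'
  · simp
  · rw [le_div_iff₀ (by positivity)]
    have h3 : w / c * d ≤ d := mul_le_of_le_one_left hd (by rw [div_le_one hc]; exact hwc)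
    have h4 : w / c * (γ * S) ≤ d := by
      rw [div_mul_eq_mul_div, div_le_iff₀ hc]
      have h5 : γ * (w * S) ≤ γ * (s * d) := mul_le_mul_of_nonneg_left h1 hγ
      have h6 : γ * s * d ≤ c * d := mul_le_mul_of_nonneg_right hγc hd
      nlinarith
    nlinarith

/-! ### The coverage potential -/

/-- One step of the potential argument: `d / (M + S)` is at most twice the increment of
`log (1 + S / M)`, since `d ≤ M`. -/
theorem sq_div_le_log_sub {d S M γ : ℝ} (hd : 0 ≤ d) (hS : 0 ≤ S) (hM : 0 < M) (hdM : d ≤ M)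
    (hγ : 0 < γ) (hγ1 : γ ≤ 1) :
    2 * d ^ 2 / (d + γ * S) ≤
      4 * M / γ * (Real.log (1 + (S + d) / M) - Real.log (1 + S / M)) := by
  have hlog : d / (M + S) ≤ 2 * (Real.log (1 + (S + d) / M) - Real.log (1 + S / M)) := by
    rw [← Real.log_div (by positivity) (by positivity)]
    have h1 : (1 + (S + d) / M) / (1 + S / M) = (M + S + d) / (M + S) := by field_simp; ring
    rw [h1]
    have h2 := Real.one_sub_inv_le_log_of_pos (x := (M + S + d) / (M + S)) (by positivity)
    have h3 : 1 - ((M + S + d) / (M + S))⁻¹ = d / (M + S + d) := by field_simp; ring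
    rw [h3] at h2
    have h4 : d / (M + S) ≤ 2 * (d / (M + S + d)) := by
      rw [← mul_div_assoc, div_le_div_iff₀ (by positivity) (by positivity)]
      nlinarith
    linarith
  have hmain : 2 * d ^ 2 / (d + γ * S) ≤ 2 * M / γ * (d / (M + S)) := by
    rcases hd.eq_or_lt with rfl | hd'
    · simp
    rw [div_mul_div_comm, div_le_div_iff₀ (by positivity) (by positivity)]
    have h5 : γ * d * M ≤ M * d := by nlinarith [mul_pos hd' hM]
    have h6 : γ * d * S ≤ γ * M * S := by
      have := mul_nonneg hγ.le hS
      nlinarith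
    have h7 : γ * d * (M + S) ≤ M * (d + γ * S) := by linarith
    nlinarith
  refine hmain.trans ?_
  calc 2 * M / γ * (d / (M + S)) ≤ 2 * M / γ *
        (2 * (Real.log (1 + (S + d) / M) - Real.log (1 + S / M))) :=
        mul_le_mul_of_nonneg_left hlog (by positivity)
    _ = _ := by ring

/-- The potential argument: a quantity bounded by `M` in every round cannot be large compared to
its own past more than logarithmically often. -/
theorem sum_sq_div_le {d : ℕ → ℝ} {M γ : ℝ} (hd : ∀ s, 0 ≤ d s) (hdM : ∀ s, d s ≤ M)
    (hγ : 0 < γ) (hγ1 : γ ≤ 1) (T : ℕ) :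
    ∑ s ∈ Finset.range T, 2 * d s ^ 2 / (d s + γ * ∑ i ∈ Finset.range s, d i) ≤
      4 * M / γ * Real.log (1 + T) := by
  rcases ((hd 0).trans (hdM 0)).eq_or_lt with rfl | hM
  · have : ∀ s, d s = 0 := fun s => le_antisymm (hdM s) (hd s)
    simp [this]
  have hstep : ∑ s ∈ Finset.range T, 2 * d s ^ 2 / (d s + γ * ∑ i ∈ Finset.range s, d i) ≤
      4 * M / γ * Real.log (1 + (∑ i ∈ Finset.range T, d i) / M) := by
    induction T with
    | zero => simp
    | succ T ih =>
      rw [Finset.sum_range_succ, Finset.sum_range_succ (f := d)]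
      have := sq_div_le_log_sub (hd T) (Finset.sum_nonneg fun i (_ : i ∈ Finset.range T) => hd i)
        hM (hdM T) hγ hγ1
      rw [mul_sub] at this
      linarith
  refine hstep.trans (mul_le_mul_of_nonneg_left (Real.log_le_log ?_ ?_) (by positivity))
  · have : 0 ≤ ∑ i ∈ Finset.range T, d i := Finset.sum_nonneg fun i _ => hd i
    positivity
  · have : ∑ i ∈ Finset.range T, d i ≤ T * M := by
      simpa using Finset.sum_le_card_nsmul (Finset.range T) d M fun i _ => hdM i
    rw [add_le_add_iff_left, div_le_iff₀ hM]
    exact this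

/-! ### Coverability -/

theorem le_mul_of_ratio_le {p q C : ℝ≥0∞} (hqt : q ≠ ∞) (hC : C ≠ ∞) (h : ratio p q ≤ C) :
    p ≤ C * q := by
  rcases eq_or_ne p 0 with rfl | hp
  · simp
  rcases eq_or_ne q 0 with rfl | hq
  · simp only [ratio, hp, false_and, if_false, ENNReal.div_zero hp, top_le_iff] at h
    exact absurd h hC
  · simp only [ratio, hp, false_and, if_false] at h
    exact (ENNReal.div_le_iff hq hqt).1 h

section

variable {X A : Type*} [Countable X] [MeasurableSpace X] [DiscreteMeasurableSpace X]
  [Countable A] [MeasurableSpace A] [DiscreteMeasurableSpace A] {H : ℕ}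

/-- The coverability coefficient of a nonempty policy class is at least `1`, since a density of a
probability distribution cannot be smaller than `1` everywhere. -/
theorem one_le_coverability [NeZero H] (M : MDP X A H) {Pol : Set (Policy X A H)}
    (hPol : Pol.Nonempty) : 1 ≤ coverability M Pol := by
  obtain ⟨π, hπ⟩ := hPol
  refine le_iInf fun μ => ?_
  by_contra! hlt
  set C := ⨆ π ∈ Pol, ⨆ h : Fin H, ⨆ x : X, ⨆ a : A, ratio (M.occ π h x a) (μ h (x, a)) with hC
  have hle : ∀ z : X × A, M.occ π 0 z.1 z.2 ≤ C * μ 0 z := fun z => by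
    refine le_mul_of_ratio_le ((μ 0).apply_ne_top z) (hlt.trans ENNReal.one_lt_top).ne ?_
    exact le_iSup₂_of_le π hπ (le_iSup_of_le 0 (le_iSup_of_le z.1 (le_iSup_of_le z.2 le_rfl)))
  have := ENNReal.tsum_le_tsum hle
  rw [M.tsum_occ, ENNReal.tsum_mul_left, (μ 0).tsum_coe, mul_one] at this
  exact absurd this (not_le.2 hlt)

/-- A finite policy class is covered by the uniform mixture of its occupancies. -/
theorem coverability_ne_top (M : MDP X A H) {F : Set (ValueFn X A H)} (hF : F.Finite)
    (hne : F.Nonempty) (greedy : ValueFn X A H → Fin H → X → A) :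
    coverability M (policyClass F greedy) ≠ ∞ := by
  have hne' : hF.toFinset.Nonempty := by simpa using hne
  let μ : Fin H → PMF (X × A) := fun h => (PMF.uniformOfFinset hF.toFinset hne').bind
    fun f => (M.occMeasure (detPolicy (greedy f)) h).toPMF
  have hN0 : (hF.toFinset.card : ℝ≥0∞) ≠ 0 := by simpa using hne.ne_empty
  have hNt : (hF.toFinset.card : ℝ≥0∞) ≠ ∞ := ENNReal.natCast_ne_top _
  refine ne_top_of_le_ne_top hNt (iInf_le_of_le μ ?_)
  refine iSup₂_le fun π hπ => iSup_le fun h => iSup_le fun x => iSup_le fun a => ?_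
  obtain ⟨f, hf, rfl⟩ := hπ
  have hle : (hF.toFinset.card : ℝ≥0∞)⁻¹ * M.occ (detPolicy (greedy f)) h x a ≤ μ h (x, a) := by
    rw [PMF.bind_apply]
    refine le_trans (le_of_eq ?_) (ENNReal.le_tsum f)
    rw [PMF.uniformOfFinset_apply_of_mem _ (by simpa using hf), Measure.toPMF_apply,
      MDP.occMeasure_singleton]
  rw [ratio]
  split_ifs with h0
  · exact Nat.one_le_cast.2 (Finset.card_pos.2 hne')
  · refine ENNReal.div_le_of_le_mul ?_
    calc M.occ (detPolicy (greedy f)) h x a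
        = hF.toFinset.card * ((hF.toFinset.card : ℝ≥0∞)⁻¹ *
            M.occ (detPolicy (greedy f)) h x a) := by
          rw [← mul_assoc, ENNReal.mul_inv_cancel hN0 hNt, one_mul]
      _ ≤ _ := by gcongr

/-- Any number above the coverability coefficient bounds all occupancies of the class by a multiple
of suitable distributions. -/
theorem exists_covering (M : MDP X A H) {Pol : Set (Policy X A H)} {C : ℝ}
    (hC : coverability M Pol < ENNReal.ofReal C) :
    ∃ μ : Fin H → PMF (X × A), ∀ π ∈ Pol, ∀ h z,
      M.occReal π h z ≤ C * (μ h z).toReal := by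
  obtain ⟨μ, hμ⟩ := iInf_lt_iff.1 hC
  refine ⟨μ, fun π hπ h z => ?_⟩
  have hC0 : 0 ≤ C := (ENNReal.ofReal_pos.1 (pos_of_gt hμ)).le
  have h1 : ratio (M.occ π h z.1 z.2) (μ h z) ≤ ENNReal.ofReal C :=
    le_trans (le_iSup₂_of_le π hπ (le_iSup_of_le h
      (le_iSup_of_le z.1 (le_iSup (fun a => ratio (M.occ π h z.1 a) (μ h (z.1, a))) z.2)))) hμ.le
  have h2 := ENNReal.toReal_mono
    (ENNReal.mul_ne_top ENNReal.ofReal_ne_top ((μ h).apply_ne_top z))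
    (le_mul_of_ratio_le ((μ h).apply_ne_top z) ENNReal.ofReal_ne_top h1)
  rwa [ENNReal.toReal_mul, ENNReal.toReal_ofReal hC0] at h2

end

section

variable {X A : Type*} [Countable X] [MeasurableSpace X] [DiscreteMeasurableSpace X]
  [Countable A] [MeasurableSpace A] [DiscreteMeasurableSpace A] {H : ℕ}

/-! ### From historical to current occupancies -/

/-- The summand of the coverage potential: up to a factor two it is `d * min 1 (d / (γ * S))`, with
`d` the occupancy of round `s` and `S` the sum of the occupancies of the rounds before. -/
noncomputable def potentialTerm (M : MDP X A H) (γ : ℝ) (h : Fin H) (ρ : ℕ → Policy X A H) (s : ℕ)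
    (z : X × A) : ℝ :=
  2 * M.occReal (ρ s) h z ^ 2 /
    (M.occReal (ρ s) h z + γ * ∑ i ∈ Finset.range s, M.occReal (ρ i) h z)

theorem potentialTerm_nonneg (M : MDP X A H) {γ : ℝ} (hγ : 0 ≤ γ) (h : Fin H)
    (ρ : ℕ → Policy X A H) (s : ℕ) (z : X × A) : 0 ≤ potentialTerm M γ h ρ s z := by
  have h1 := M.occReal_nonneg (ρ s) h z
  have h2 : 0 ≤ ∑ i ∈ Finset.range s, M.occReal (ρ i) h z :=
    Finset.sum_nonneg fun i _ => M.occReal_nonneg (ρ i) h z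
  exact div_nonneg (mul_nonneg zero_le_two (sq_nonneg _)) (add_nonneg h1 (mul_nonneg hγ h2))

theorem summable_potentialTerm (M : MDP X A H) {γ : ℝ} (hγ : 0 ≤ γ) (h : Fin H)
    (ρ : ℕ → Policy X A H) (s : ℕ) : Summable (potentialTerm M γ h ρ s) := by
  refine Summable.of_nonneg_of_le (potentialTerm_nonneg M hγ h ρ s) (fun z => ?_)
    ((M.hasSum_occReal (ρ s) h).summable.mul_left 2)
  have h1 := M.occReal_nonneg (ρ s) h z
  have h2 : 0 ≤ ∑ i ∈ Finset.range s, M.occReal (ρ i) h z :=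
    Finset.sum_nonneg fun i _ => M.occReal_nonneg (ρ i) h z
  have h3 := mul_nonneg hγ h2
  unfold potentialTerm
  generalize M.occReal (ρ s) h z = d at *
  generalize γ * ∑ i ∈ Finset.range s, M.occReal (ρ i) h z = q at *
  refine div_le_of_le_mul₀ (add_nonneg h1 h3) (by linarith) ?_
  nlinarith [mul_nonneg h1 h3]

theorem sum_tsum_potentialTerm_le (M : MDP X A H) {γ C : ℝ} (hγ : 0 < γ) (hγ1 : γ ≤ 1)
    (h : Fin H) (ρ : ℕ → Policy X A H) (μ : PMF (X × A))
    (hμ : ∀ s z, M.occReal (ρ s) h z ≤ C * (μ z).toReal) (T : ℕ) :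
    ∑ s ∈ Finset.range T, ∑' z, potentialTerm M γ h ρ s z ≤ 4 * C / γ * Real.log (1 + T) := by
  have hsμ : HasSum (fun z => (μ z).toReal) 1 := by
    have h1 := ENNReal.hasSum_toReal (f := fun z => μ z) (by rw [μ.tsum_coe]; simp)
    rwa [← ENNReal.tsum_toReal_eq fun z => μ.apply_ne_top z, μ.tsum_coe, ENNReal.toReal_one] at h1
  rw [← Summable.tsum_finsetSum fun s _ => summable_potentialTerm M hγ.le h ρ s]
  have hs := (hsμ.mul_left (4 * C / γ * Real.log (1 + T)))
  rw [mul_one] at hs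
  refine (Summable.tsum_le_tsum (fun z => ?_)
    (summable_sum fun s _ => summable_potentialTerm M hγ.le h ρ s) hs.summable).trans
    hs.tsum_eq.le
  have := sum_sq_div_le (d := fun s => M.occReal (ρ s) h z) (fun s => M.occReal_nonneg _ h z)
    (fun s => hμ s z) hγ hγ1 T
  refine this.trans (le_of_eq ?_)
  ring

/-- Change of measure with a weight from the augmented class: the weight `d / d̄`, where `d` is the
occupancy of round `s` and `d̄` is the average occupancy of the rounds before, is a mixture of pure
density ratios; the price of clipping it is paid by the coverage potential. -/
theorem exists_augmented_changeOfMeasure (M : MDP X A H) {Pol : Set (Policy X A H)}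
    {W : Set (WeightFn X A H)} (hW : DensityRatioRealizable M Pol W) {ρ : ℕ → Policy X A H}
    (hρ : ∀ s, ρ s ∈ Pol) {γ c : ℝ} (hγ : 0 ≤ γ) {s T : ℕ} (hs : 1 ≤ s) (hsT : s ≤ T) (hc : 0 < c)
    (hγc : γ * s ≤ c) (h : Fin H) :
    ∃ w ∈ augmented W T,
      (∀ b : X → A → ℝ, (∀ x a, |b x a| ≤ 2) →
        ∫ τ, b (τ h).1 (τ h).2.1 ∂(M.trajLaw (ρ s)) ≤
          1 / s * ∑ i ∈ Finset.range s, ∫ τ, b (τ h).1 (τ h).2.1 *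
            clip (w h (τ h).1 (τ h).2.1) c ∂(M.trajLaw (ρ i)) +
          2 * ∑' z, potentialTerm M γ h ρ s z) ∧
      1 / s * (∑ i ∈ Finset.range s, ∫ τ, clip (w h (τ h).1 (τ h).2.1) c ^ 2
        ∂(M.trajLaw (ρ i))) / c ≤ ∑' z, potentialTerm M γ h ρ s z := by
  have hsr : (0 : ℝ) < s := by exact_mod_cast hs
  choose v hv hvr using fun i : Fin s => hW (ρ i) (hρ i) (ρ s) (hρ s) h
  refine ⟨mixture v, ⟨s, hs, hsT, v, hv, rfl⟩, ?_⟩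
  have hclip : ∀ z : X × A,
      clip (mixture v h z.1 z.2) c * ∑ i ∈ Finset.range s, M.occReal (ρ i) h z ≤
        s * M.occReal (ρ s) h z ∧
      (clip (mixture v h z.1 z.2) c * ∑ i ∈ Finset.range s, M.occReal (ρ i) h z =
        s * M.occReal (ρ s) h z ∨ clip (mixture v h z.1 z.2) c = c) := fun z => by
    have := clip_mixture_ratio hs hc (M.occ (ρ s) h z.1 z.2) (M.occ_ne_top _ _ _ _)
      (fun i : Fin s => M.occ (ρ i) h z.1 z.2) fun i => M.occ_ne_top _ _ _ _
    simp_rw [← hvr] at this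
    rw [Fin.sum_univ_eq_sum_range (fun i => (M.occ (ρ i) h z.1 z.2).toReal) s] at this
    exact this
  set w : X × A → ℝ := fun z => clip (mixture v h z.1 z.2) c with hw
  have hw0 : ∀ z, 0 ≤ w z := fun z => clip_nonneg _ _
  have hwc : ∀ z, w z ≤ c := fun z => clip_le _ hc.le
  have hwa : ∀ z, |w z| ≤ c := fun z => by rw [abs_of_nonneg (hw0 z)]; exact hwc z
  have hS0 : ∀ z, 0 ≤ ∑ i ∈ Finset.range s, M.occReal (ρ i) h z := fun z =>
    Finset.sum_nonneg fun i _ => M.occReal_nonneg (ρ i) h z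
  have hsP := (summable_potentialTerm M hγ h ρ s).hasSum
  constructor
  · intro b hb
    have h1 := M.hasSum_occReal_mul (ρ s) h (G := fun z => b z.1 z.2) (fun z => hb z.1 z.2)
    have h2 := fun i => M.hasSum_occReal_mul (ρ i) h (G := fun z => b z.1 z.2 * w z) (C := 2 * c)
      fun z => by
        rw [abs_mul]
        exact mul_le_mul (hb _ _) (hwa z) (abs_nonneg _) (by norm_num)
    have h3 := (hasSum_sum fun i (_ : i ∈ Finset.range s) => h2 i).mul_left (1 / (s : ℝ))
    refine hasSum_le (fun z => ?_) h1 (h3.add (hsP.mul_left 2))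
    have := mul_le_clip_mul_add hsr hc (M.occReal_nonneg (ρ s) h z) (hS0 z) hγ hγc
      (hclip z).1 (hclip z).2 (hb z.1 z.2)
    refine this.trans (le_of_eq ?_)
    rw [← Finset.sum_mul, potentialTerm]
    simp only [hw]
    ring
  · have h2 := fun i => M.hasSum_occReal_mul (ρ i) h (G := fun z => w z ^ 2) (C := c ^ 2)
      fun z => by
        rw [abs_pow]
        exact pow_le_pow_left₀ (abs_nonneg _) (hwa z) 2
    have h3 := ((hasSum_sum fun i (_ : i ∈ Finset.range s) => h2 i).mul_left
      (1 / (s : ℝ))).div_const c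
    refine hasSum_le (fun z => ?_) h3 hsP
    have := clip_sq_le hsr hc (M.occReal_nonneg (ρ s) h z) (hS0 z) hγ hγc (hw0 z) (hwc z)
      (hclip z).1
    refine le_trans (le_of_eq ?_) this
    rw [← Finset.sum_mul]
    ring

/-- The regret bound given the two consequences of the confidence sets: optimism, and small Bellman
errors under the historical data after reweighting. -/
theorem sum_regret_le [NeZero H] (M : MDP X A H) {F : Set (ValueFn X A H)}
    (hF : ∀ f ∈ F, ∀ h x a, f h x a ∈ Set.Icc (0 : ℝ) 1)
    {greedy : ValueFn X A H → Fin H → X → A} (hgreedy : IsGreedyRule F greedy)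
    {W : Set (WeightFn X A H)} (hW : DensityRatioRealizable M (policyClass F greedy) W)
    {γ C Jstar : ℝ} (hγ : 0 < γ) (hγ1 : γ ≤ 1)
    (hcov : coverability M (policyClass F greedy) < ENNReal.ofReal C)
    {φ : ℕ → ValueFn X A H} (hφ : ∀ s, φ s ∈ F) {T : ℕ} (hT : 1 ≤ T) (hJ1 : Jstar ≤ 1)
    (hopt : ∀ s, 1 ≤ s → s < T → Jstar ≤
      ∫ x, φ s 0 x (greedy (φ s) 0 x) ∂M.d₁.toMeasure + (2 * γ + 2 / (s * γ)))
    (hbell : ∀ s, 1 ≤ s → s < T → ∀ h : Fin H, ∀ w ∈ augmented W T,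
      1 / (s : ℝ) * ∑ i ∈ Finset.range s, ∫ τ, M.bellmanError (φ s) h (τ h).1 (τ h).2.1 *
          clip (w h (τ h).1 (τ h).2.1) (gammaAt γ s) ∂(M.trajLaw (detPolicy (greedy (φ i)))) ≤
        106 * γ + 16 * (1 / s * (∑ i ∈ Finset.range s,
          ∫ τ, clip (w h (τ h).1 (τ h).2.1) (gammaAt γ s) ^ 2
            ∂(M.trajLaw (detPolicy (greedy (φ i))))) / gammaAt γ s)) :
    ∑ s ∈ Finset.range T, (Jstar - M.J (detPolicy (greedy (φ s)))) ≤
      1 + T * (2 * γ + 106 * H * γ) + 2 / γ * (1 + Real.log T) +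
        H * (72 * C / γ * Real.log (1 + T)) := by
  set ρ : ℕ → Policy X A H := fun s => detPolicy (greedy (φ s)) with hρdef
  have hρ : ∀ s, ρ s ∈ policyClass F greedy := fun s => ⟨φ s, hφ s, rfl⟩
  obtain ⟨μ, hμ⟩ := exists_covering M hcov
  have hround : ∀ s, 1 ≤ s → s < T → Jstar - M.J (ρ s) ≤ (2 * γ + 106 * H * γ) + 2 / γ * (1 / s) +
      ∑ h, 18 * ∑' z, potentialTerm M γ h ρ s z := by
    intro s hs hsT
    have hsr : (0 : ℝ) < s := by exact_mod_cast hs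
    have hc : 0 < gammaAt γ s := by unfold gammaAt; positivity
    have hγc : γ * s ≤ gammaAt γ s := by unfold gammaAt; nlinarith
    have hgap := MDP.integral_sub_J_eq M (hF _ (hφ s)) (hgreedy _ (hφ s))
    have hb : ∀ h, ∫ τ, M.bellmanError (φ s) h (τ h).1 (τ h).2.1 ∂(M.trajLaw (ρ s)) ≤
        106 * γ + 18 * ∑' z, potentialTerm M γ h ρ s z := fun h => by
      obtain ⟨w, hw, h1, h2⟩ := exists_augmented_changeOfMeasure M hW hρ hγ.le hs hsT.le hc hγc h
      have h3 := h1 _ (M.abs_bellmanError_le (hF _ (hφ s)) h)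
      have h4 := hbell s hs hsT h w hw
      linarith
    have hsum := Finset.sum_le_sum fun h (_ : h ∈ Finset.univ) => hb h
    rw [Finset.sum_add_distrib, Finset.sum_const, Finset.card_univ, Fintype.card_fin,
      nsmul_eq_mul] at hsum
    have h5 := hopt s hs hsT
    have h6 : 2 / ((s : ℝ) * γ) = 2 / γ * (1 / s) := by
      rw [div_mul_div_comm, mul_one, mul_comm]
    rw [h6] at h5
    linarith
  have hJ0 : 0 ≤ M.J (ρ 0) := integral_nonneg fun τ => totalReward_nonneg τ
  have hpot0 : ∀ s, 0 ≤ ∑ h, 18 * ∑' z, potentialTerm M γ h ρ s z := fun s =>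
    Finset.sum_nonneg fun h _ => mul_nonneg (by norm_num)
      (tsum_nonneg (potentialTerm_nonneg M hγ.le h ρ s))
  -- the first round, which has no data, costs at most `1`
  have hall : ∀ s ∈ Finset.range T, Jstar - M.J (ρ s) ≤
      (if s = 0 then 1 else 0) + (2 * γ + 106 * H * γ) + 2 / γ * (1 / s) +
        ∑ h, 18 * ∑' z, potentialTerm M γ h ρ s z := fun s hs => by
    rcases Nat.eq_zero_or_pos s with rfl | hpos
    · have := hpot0 0
      have h7 : 0 ≤ 2 * γ + 106 * H * γ := by positivity
      simp only [if_true, Nat.cast_zero, div_zero, mul_zero]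
      linarith
    · have := hround s hpos (Finset.mem_range.1 hs)
      simp only [hpos.ne', if_false]
      linarith
  refine (Finset.sum_le_sum hall).trans ?_
  rw [Finset.sum_add_distrib, Finset.sum_add_distrib, Finset.sum_add_distrib, Finset.sum_const,
    Finset.card_range, nsmul_eq_mul, Finset.sum_ite_eq', if_pos (Finset.mem_range.2 hT),
    ← Finset.mul_sum]
  have hharm : ∑ s ∈ Finset.range T, 1 / (s : ℝ) ≤ 1 + Real.log T := by
    obtain ⟨n, rfl⟩ : ∃ n, T = n + 1 := ⟨T - 1, by omega⟩
    have h8 := harmonic_le_one_add_log (n + 1)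
    have h9 : ∑ s ∈ Finset.range (n + 1), 1 / (s : ℝ) ≤ ((harmonic (n + 1) : ℚ) : ℝ) := by
      rw [Finset.sum_range_succ', harmonic, Finset.sum_range_succ]
      push_cast
      have : (0 : ℝ) ≤ ((n : ℝ) + 1)⁻¹ := by positivity
      simp only [one_div]
      simpa using this
    exact h9.trans h8
  have hpot : ∑ s ∈ Finset.range T, ∑ h, 18 * ∑' z, potentialTerm M γ h ρ s z ≤
      H * (72 * C / γ * Real.log (1 + T)) := by
    rw [Finset.sum_comm]
    have : ∀ h ∈ Finset.univ, ∑ s ∈ Finset.range T, 18 * ∑' z, potentialTerm M γ h ρ s z ≤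
        72 * C / γ * Real.log (1 + T) := fun h _ => by
      rw [← Finset.mul_sum]
      have h10 := sum_tsum_potentialTerm_le M hγ hγ1 h ρ (μ h) (fun s z => hμ _ (hρ s) h z) T
      refine (mul_le_mul_of_nonneg_left h10 (by norm_num)).trans (le_of_eq ?_)
      ring
    refine (Finset.sum_le_card_nsmul _ _ _ this).trans (le_of_eq ?_)
    simp
  have h11 : 2 / γ * ∑ s ∈ Finset.range T, 1 / (s : ℝ) ≤ 2 / γ * (1 + Real.log T) :=
    mul_le_mul_of_nonneg_left hharm (by positivity)
  linarith

end

/-! ### The augmented class -/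

section

variable {X A : Type*} {H : ℕ}

theorem augmented_eq_range (W : Set (WeightFn X A H)) (T : ℕ) :
    augmented W T = Set.range fun p : (t : Fin T) × (Fin (t + 1) → W) =>
      mixture fun s => (p.2 s : WeightFn X A H) := by
  ext v
  constructor
  · rintro ⟨t, ht1, htT, w, hw, rfl⟩
    obtain ⟨t, rfl⟩ : ∃ k, t = k + 1 := ⟨t - 1, by omega⟩
    exact ⟨⟨⟨t, by omega⟩, fun s => ⟨w s, hw s⟩⟩, rfl⟩
  · rintro ⟨⟨t, w⟩, rfl⟩
    exact ⟨t + 1, by omega, by omega, _, fun s => (w s).2, rfl⟩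

theorem finite_augmented {W : Set (WeightFn X A H)} (hW : W.Finite) (T : ℕ) :
    (augmented W T).Finite := by
  have := hW.to_subtype
  rw [augmented_eq_range]
  exact Set.finite_range _

/-- Every mixture is determined by its length `t ≤ T` and `t` elements of `W`. -/
theorem ncard_augmented_le {W : Set (WeightFn X A H)} (hW : W.Finite) (hne : W.Nonempty) (T : ℕ) :
    (augmented W T).ncard ≤ T * W.ncard ^ T := by
  have := hW.to_subtype
  have h1 : 1 ≤ W.ncard := (Set.ncard_pos hW).2 hne
  rw [augmented_eq_range, ← Nat.card_coe_set_eq]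
  refine (Finite.card_range_le _).trans ?_
  rw [Nat.card_sigma]
  refine (Finset.sum_le_card_nsmul _ _ (W.ncard ^ T) fun t _ => ?_).trans (by simp)
  rw [Nat.card_fun, Nat.card_coe_set_eq, Nat.card_fin]
  exact Nat.pow_le_pow_right h1 t.isLt

theorem augmented_nonempty {W : Set (WeightFn X A H)} (hne : W.Nonempty) {T : ℕ} (hT : 1 ≤ T) :
    (augmented W T).Nonempty := by
  obtain ⟨w, hw⟩ := hne
  exact ⟨_, 1, le_rfl, hT, fun _ => w, fun _ => hw, rfl⟩

end

section

variable {X A : Type*} [Countable X] [MeasurableSpace X] [DiscreteMeasurableSpace X]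
  [Countable A] [MeasurableSpace A] [DiscreteMeasurableSpace A] {H K : ℕ}
  {M : MDP X A H} {pol : (s : ℕ) → Dataset X A H K s → Policy X A H}

/-! ### Good events -/

/-- The concentration inequality, simultaneously for a finite family of functions. -/
theorem one_sub_le_dataLaw_forall_excess_le (hpol : ∀ s, IsFiniteRule (pol s)) {ι : Type*}
    [Finite ι] (g : ι → Traj X A H → ℝ) (hg : ∀ i, Measurable (g i)) (hb : ∀ i τ, |g i τ| ≤ 1)
    {T : ℕ} (s : ι → ℕ) (hs : ∀ i, s i ≤ T) {L δ : ℝ} (hL : Nat.card ι * Real.exp (-L) ≤ δ) :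
    ENNReal.ofReal (1 - δ) ≤ dataLaw M K pol T
      {D | ∀ i, excess pol (g i) (compensator M (g i)) (dataPrefix (hs i) D) ≤ L} := by
  have := Fintype.ofFinite ι
  have hprob := isProbabilityMeasure_dataLaw (M := M) hpol T
  set S := {D | ∀ i, excess pol (g i) (compensator M (g i)) (dataPrefix (hs i) D) ≤ L} with hS
  have hcompl : Sᶜ ⊆
      ⋃ i, {D | L < excess pol (g i) (compensator M (g i)) (dataPrefix (hs i) D)} := fun D hD => by
    simp only [hS, Set.mem_compl_iff, Set.mem_ofPred_eq, not_forall, not_le] at hD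
    simpa using hD
  have hbad : dataLaw M K pol T Sᶜ ≤ ENNReal.ofReal δ := by
    calc dataLaw M K pol T Sᶜ ≤ ∑ i, dataLaw M K pol T
          {D | L < excess pol (g i) (compensator M (g i)) (dataPrefix (hs i) D)} :=
          (measure_mono hcompl).trans (measure_iUnion_fintype_le _ _)
      _ ≤ ∑ _i : ι, ENNReal.ofReal (Real.exp (-L)) :=
          Finset.sum_le_sum fun i _ => dataLaw_excess_gt_le hpol (hg i) (hb i) (hs i) L
      _ = ENNReal.ofReal (Nat.card ι * Real.exp (-L)) := by
          rw [Finset.sum_const, Finset.card_univ, nsmul_eq_mul, Nat.card_eq_fintype_card,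
            ENNReal.ofReal_mul (Nat.cast_nonneg _), ENNReal.ofReal_natCast]
      _ ≤ _ := ENNReal.ofReal_le_ofReal hL
  have hδ : 0 ≤ δ := le_trans (by positivity) hL
  rw [ENNReal.ofReal_sub _ hδ, ENNReal.ofReal_one, tsub_le_iff_right]
  calc (1 : ℝ≥0∞) = dataLaw M K pol T (S ∪ Sᶜ) := by rw [Set.union_compl_self, measure_univ]
    _ ≤ dataLaw M K pol T S + dataLaw M K pol T Sᶜ := measure_union_le _ _
    _ ≤ _ := by gcongr

theorem empMean_const_mul {s : ℕ} (D : Dataset X A H K s) (a : ℝ) (g : Traj X A H → ℝ) :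
    empMean D (fun τ => a * g τ) = a * empMean D g := by
  simp only [empMean, ← Finset.mul_sum, mul_div_assoc]

/-- The excess in terms of the empirical mean, when `ρ i` is the policy of round `i + 1`. -/
theorem excess_eq {s : ℕ} (hK : 0 < K) (hs : 0 < s) (D : Dataset X A H K s) (g : Traj X A H → ℝ)
    (ψ : Policy X A H → ℝ) {ρ : ℕ → Policy X A H}
    (hρ : ∀ i : Fin s, pol i (dataPrefix i.isLt.le D) = ρ i) :
    excess pol g ψ D = K * s * empMean D g - K * ∑ i ∈ Finset.range s, ψ (ρ i) := by
  have hKr : (0 : ℝ) < K := by exact_mod_cast hK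
  have hsr : (0 : ℝ) < s := by exact_mod_cast hs
  simp only [excess, hρ]
  rw [Finset.sum_sub_distrib, ← Finset.mul_sum, Fin.sum_univ_eq_sum_range (fun i => ψ (ρ i)) s,
    empMean, mul_div_cancel₀]
  positivity

/-- The summand of the constraint that defines the confidence set, with clipping level `c`; the
penalty coefficient `alphaAt` is `8 / c` when `c` is `gammaAt`. -/
noncomputable def penalizedResidual (f : ValueFn X A H) (w : WeightFn X A H) (c : ℝ) (h : Fin H)
    (τ : Traj X A H) : ℝ :=
  residual f h τ * clip (w h (τ h).1 (τ h).2.1) c -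
    8 / c * clip (w h (τ h).1 (τ h).2.1) c ^ 2

theorem measurable_clip (w : WeightFn X A H) (c : ℝ) (h : Fin H) :
    Measurable fun τ : Traj X A H => clip (w h (τ h).1 (τ h).2.1) c :=
  MDP.measurable_stateAction (fun x a => clip (w h x a) c) h

theorem measurable_penalizedResidual (f : ValueFn X A H) (w : WeightFn X A H) (c : ℝ) (h : Fin H) :
    Measurable (penalizedResidual f w c h) :=
  ((MDP.measurable_residual f h).mul (measurable_clip w c h)).sub
    (((measurable_clip w c h).pow_const 2).const_mul _)

variable {f : ValueFn X A H}

theorem abs_penalizedResidual_le (hf : ∀ h x a, f h x a ∈ Set.Icc (0 : ℝ) 1) (w : WeightFn X A H)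
    {c : ℝ} (hc : 0 < c) (h : Fin H) (τ : Traj X A H) :
    |penalizedResidual f w c h τ| ≤ 10 * clip (w h (τ h).1 (τ h).2.1) c := by
  have h1 := abs_residual_le hf h τ
  have h2 := clip_nonneg (w h (τ h).1 (τ h).2.1) c
  have h3 := clip_le (w h (τ h).1 (τ h).2.1) hc.le
  rw [penalizedResidual]
  set v := clip (w h (τ h).1 (τ h).2.1) c
  have h4 : 8 / c * v ^ 2 ≤ 8 * v := by
    rw [div_mul_eq_mul_div, div_le_iff₀ hc]
    nlinarith
  have h5 : |residual f h τ * v| ≤ 2 * v := by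
    rw [abs_mul, abs_of_nonneg h2]
    exact mul_le_mul_of_nonneg_right h1 h2
  have h6 : |8 / c * v ^ 2| ≤ 8 * v := by rwa [abs_of_nonneg (by positivity)]
  have := abs_sub (residual f h τ * v) (8 / c * v ^ 2)
  linarith

theorem penalizedResidual_sq_le (hf : ∀ h x a, f h x a ∈ Set.Icc (0 : ℝ) 1) (w : WeightFn X A H)
    {c : ℝ} (hc : 0 < c) (h : Fin H) (τ : Traj X A H) :
    penalizedResidual f w c h τ ^ 2 ≤ 136 * clip (w h (τ h).1 (τ h).2.1) c ^ 2 := by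
  have h1 := abs_penalizedResidual_le hf w hc h τ
  have h2 := clip_nonneg (w h (τ h).1 (τ h).2.1) c
  rw [← sq_abs]
  nlinarith [abs_nonneg (penalizedResidual f w c h τ)]

/-- The compensator of the (rescaled) penalized residual. The scale `1 / (17 c)` is chosen so that
the second moment of the residual is dominated by the quadratic penalty. -/
theorem compensator_penalizedResidual_le (M : MDP X A H) (π : Policy X A H)
    (hf : ∀ h x a, f h x a ∈ Set.Icc (0 : ℝ) 1) (w : WeightFn X A H) {c : ℝ} (hc : 0 < c)
    (h : Fin H) {a : ℝ} (ha : a ^ 2 = (1 / (17 * c)) ^ 2) :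
    compensator M (fun τ => a * penalizedResidual f w c h τ) π ≤
      a * ∫ τ, M.bellmanError f h (τ h).1 (τ h).2.1 * clip (w h (τ h).1 (τ h).2.1) c
        ∂(M.trajLaw π) +
      (1 / (17 * c) - a) * (8 / c) *
        ∫ τ, clip (w h (τ h).1 (τ h).2.1) c ^ 2 ∂(M.trajLaw π) := by
  have hcl : ∀ x a, |clip (w h x a) c| ≤ c := fun x a => by
    rw [abs_of_nonneg (clip_nonneg _ _)]; exact clip_le _ hc.le
  have i2 : Integrable (fun τ : Traj X A H => clip (w h (τ h).1 (τ h).2.1) c ^ 2)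
      (M.trajLaw π) :=
    integrable_of_bounded (C := c ^ 2) ((measurable_clip w c h).pow_const 2) fun τ => by
      rw [abs_pow]; exact pow_le_pow_left₀ (abs_nonneg _) (hcl _ _) 2
  have i1 : Integrable (fun τ : Traj X A H =>
      residual f h τ * clip (w h (τ h).1 (τ h).2.1) c) (M.trajLaw π) :=
    integrable_of_bounded (C := 2 * c)
      ((MDP.measurable_residual f h).mul (measurable_clip w c h)) fun τ => by
        rw [abs_mul]
        exact mul_le_mul (abs_residual_le hf h τ) (hcl _ _) (abs_nonneg _) zero_le_two
  have hmean : ∫ τ, a * penalizedResidual f w c h τ ∂(M.trajLaw π) =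
      a * (∫ τ, M.bellmanError f h (τ h).1 (τ h).2.1 * clip (w h (τ h).1 (τ h).2.1) c
        ∂(M.trajLaw π) - 8 / c * ∫ τ, clip (w h (τ h).1 (τ h).2.1) c ^ 2 ∂(M.trajLaw π)) := by
    rw [integral_const_mul]
    unfold penalizedResidual
    rw [integral_sub i1 (i2.const_mul _), integral_const_mul,
      M.integral_residual_mul π hf h (G := fun x a => clip (w h x a) c) hcl]
  have hsq : ∫ τ, (a * penalizedResidual f w c h τ) ^ 2 ∂(M.trajLaw π) ≤
      1 / (17 * c) * (8 / c) * ∫ τ, clip (w h (τ h).1 (τ h).2.1) c ^ 2 ∂(M.trajLaw π) := by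
    rw [← integral_const_mul]
    refine integral_mono_of_nonneg (Filter.Eventually.of_forall fun τ => sq_nonneg _)
      (i2.const_mul _) (Filter.Eventually.of_forall fun τ => ?_)
    simp only
    rw [mul_pow, ha]
    have h1 := penalizedResidual_sq_le hf w hc h τ
    -- `136 = 17 * 8`: the scale turns the second moment into the penalty coefficient
    have h2 : 1 / (17 * c) * (8 / c) = (1 / (17 * c)) ^ 2 * 136 := by
      field_simp; norm_num
    rw [h2, mul_assoc]
    exact mul_le_mul_of_nonneg_left h1 (sq_nonneg _)
  rw [compensator, hmean]
  nlinarith [hsq]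

/-- The compensator of a (rescaled) function of the initial state, whose mean does not depend on the
policy. -/
theorem compensator_value_le [NeZero H] (M : MDP X A H) (π : Policy X A H) {u : X → ℝ}
    (hu : ∀ x, |u x| ≤ 1) {a : ℝ} :
    compensator M (fun τ => a * u (τ 0).1) π ≤ a * ∫ x, u x ∂M.d₁.toMeasure + a ^ 2 := by
  have h1 : ∫ τ, a * u (τ 0).1 ∂(M.trajLaw π) = a * ∫ x, u x ∂M.d₁.toMeasure := by
    rw [integral_const_mul, M.integral_trajLaw_zero_fst π hu]
  have h2 : ∫ τ, (a * u (τ 0).1) ^ 2 ∂(M.trajLaw π) ≤ a ^ 2 := by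
    refine (le_abs_self _).trans (abs_integral_le_of_bounded fun τ => ?_)
    rw [mul_pow, abs_mul, abs_of_nonneg (sq_nonneg a), abs_pow]
    exact mul_le_of_le_one_right (sq_nonneg a) (pow_le_one₀ (abs_nonneg _) (hu _))
  rw [compensator, h1]
  linarith

end

section

variable {X A : Type*} [Countable X] [MeasurableSpace X] [DiscreteMeasurableSpace X]
  [Countable A] [MeasurableSpace A] [DiscreteMeasurableSpace A] {H K : ℕ}
  {M : MDP X A H} {pol : (s : ℕ) → Dataset X A H K s → Policy X A H}

/-! ### Consequences of concentration for the confidence sets -/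

theorem gammaAt_pos {γ : ℝ} (hγ : 0 < γ) (s : ℕ) : 0 < gammaAt γ s := by
  unfold gammaAt; positivity

/-- `Q^⋆` satisfies a constraint of the confidence set: its Bellman error vanishes, and the
quadratic penalty absorbs the fluctuations of its residual. -/
theorem empMean_penalizedResidual_le {s : ℕ} (hK : 0 < K) (hs : 0 < s) {D : Dataset X A H K s}
    {ρ : ℕ → Policy X A H} (hρ : ∀ i : Fin s, pol i (dataPrefix i.isLt.le D) = ρ i)
    {f : ValueFn X A H} (hf : ∀ h x a, f h x a ∈ Set.Icc (0 : ℝ) 1) {w : WeightFn X A H} {c L : ℝ}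
    (hc : 0 < c) (h : Fin H) (hb : ∀ x a, M.bellmanError f h x a = 0) (hL : 0 ≤ L)
    (hexc : excess pol (fun τ => 1 / (17 * c) * penalizedResidual f w c h τ)
      (compensator M fun τ => 1 / (17 * c) * penalizedResidual f w c h τ) D ≤ L) :
    empMean D (penalizedResidual f w c h) ≤ 36 * c / (K * s) * L := by
  have hKr : (0 : ℝ) < K := by exact_mod_cast hK
  have hsr : (0 : ℝ) < s := by exact_mod_cast hs
  rw [excess_eq hK hs D _ _ hρ, empMean_const_mul] at hexc
  have hcomp : ∑ i ∈ Finset.range s,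
      compensator M (fun τ => 1 / (17 * c) * penalizedResidual f w c h τ) (ρ i) ≤ 0 := by
    refine Finset.sum_nonpos fun i _ => ?_
    have := compensator_penalizedResidual_le M (ρ i) hf w hc h (a := 1 / (17 * c)) rfl
    simpa [hb] using this
  have h1 : K * s * (1 / (17 * c) * empMean D (penalizedResidual f w c h)) ≤ L := by
    nlinarith [mul_nonpos_of_nonneg_of_nonpos hKr.le hcomp]
  have h2 : K * s * (1 / (17 * c) * empMean D (penalizedResidual f w c h)) =
      K * s * empMean D (penalizedResidual f w c h) / (17 * c) := by ring
  rw [h2, div_le_iff₀ (by positivity)] at h1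
  rw [div_mul_eq_mul_div, le_div_iff₀ (by positivity)]
  nlinarith [mul_nonneg hc.le hL]

/-- An empirical constraint bounds the reweighted Bellman error under the historical data. -/
theorem sum_bellmanError_clip_le {s : ℕ} (hK : 0 < K) (hs : 0 < s) {D : Dataset X A H K s}
    {ρ : ℕ → Policy X A H} (hρ : ∀ i : Fin s, pol i (dataPrefix i.isLt.le D) = ρ i)
    {f : ValueFn X A H} (hf : ∀ h x a, f h x a ∈ Set.Icc (0 : ℝ) 1) {w : WeightFn X A H} {c L : ℝ}
    (hc : 0 < c) (h : Fin H)
    (hexc : excess pol (fun τ => -(1 / (17 * c)) * penalizedResidual f w c h τ)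
      (compensator M fun τ => -(1 / (17 * c)) * penalizedResidual f w c h τ) D ≤ L)
    (hcon : empMean D (penalizedResidual f w c h) ≤ 36 * c / (K * s) * L) :
    1 / (s : ℝ) * ∑ i ∈ Finset.range s, ∫ τ, M.bellmanError f h (τ h).1 (τ h).2.1 *
        clip (w h (τ h).1 (τ h).2.1) c ∂(M.trajLaw (ρ i)) ≤
      53 * c / (K * s) * L + 16 * (1 / s * (∑ i ∈ Finset.range s,
        ∫ τ, clip (w h (τ h).1 (τ h).2.1) c ^ 2 ∂(M.trajLaw (ρ i))) / c) := by
  have hKr : (0 : ℝ) < K := by exact_mod_cast hK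
  have hsr : (0 : ℝ) < s := by exact_mod_cast hs
  rw [excess_eq hK hs D _ _ hρ, empMean_const_mul] at hexc
  have hcomp := Finset.sum_le_sum fun i (_ : i ∈ Finset.range s) =>
    compensator_penalizedResidual_le M (ρ i) hf w hc h (a := -(1 / (17 * c))) (neg_sq _)
  rw [Finset.sum_add_distrib, ← Finset.mul_sum, ← Finset.mul_sum] at hcomp
  set B := ∑ i ∈ Finset.range s, ∫ τ, M.bellmanError f h (τ h).1 (τ h).2.1 *
        clip (w h (τ h).1 (τ h).2.1) c ∂(M.trajLaw (ρ i))
  set V := ∑ i ∈ Finset.range s,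
        ∫ τ, clip (w h (τ h).1 (τ h).2.1) c ^ 2 ∂(M.trajLaw (ρ i))
  set E := empMean D (penalizedResidual f w c h)
  have h1 : K * s * (-(1 / (17 * c)) * E) -
      K * (-(1 / (17 * c)) * B + (1 / (17 * c) - -(1 / (17 * c))) * (8 / c) * V) ≤ L := by
    have := mul_le_mul_of_nonneg_left hcomp hKr.le
    linarith
  have h2 : K * s * (-(1 / (17 * c)) * E) -
      K * (-(1 / (17 * c)) * B + (1 / (17 * c) - -(1 / (17 * c))) * (8 / c) * V) =
      (K * B - K * (16 * (V / c)) - K * s * E) / (17 * c) := by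
    field_simp; ring
  rw [h2, div_le_iff₀ (by positivity)] at h1
  rw [div_mul_eq_mul_div, le_div_iff₀ (by positivity)] at hcon
  have h3 : K * B ≤ 53 * c * L + K * (16 * (V / c)) := by linarith
  have h4 : 53 * c / (K * s) * L + 16 * (1 / s * V / c) =
      (53 * c * L + K * (16 * (V / c))) / (K * s) := by
    field_simp
  have h5 : 1 / (s : ℝ) * B = K * B / (K * s) := by field_simp
  rw [h4, h5]
  exact div_le_div_of_nonneg_right h3 (by positivity)

/-- The empirical mean of a function of the initial state against its mean under `d₁`; a negative
`a` gives the lower bound. -/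
theorem mul_empMean_value_le [NeZero H] {s : ℕ} (hK : 0 < K) (hs : 0 < s) {D : Dataset X A H K s}
    {ρ : ℕ → Policy X A H} (hρ : ∀ i : Fin s, pol i (dataPrefix i.isLt.le D) = ρ i)
    {u : X → ℝ} (hu : ∀ x, |u x| ≤ 1) {a L : ℝ}
    (hexc : excess pol (fun τ => a * u (τ 0).1) (compensator M fun τ => a * u (τ 0).1) D ≤ L) :
    a * empMean D (fun τ => u (τ 0).1) ≤
      a * ∫ x, u x ∂M.d₁.toMeasure + (a ^ 2 + L / (K * s)) := by
  have hKr : (0 : ℝ) < K := by exact_mod_cast hK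
  have hsr : (0 : ℝ) < s := by exact_mod_cast hs
  rw [excess_eq hK hs D _ _ hρ, empMean_const_mul] at hexc
  have hcomp := Finset.sum_le_card_nsmul (Finset.range s) _ _
    fun i _ => compensator_value_le M (ρ i) hu (a := a)
  rw [Finset.card_range, nsmul_eq_mul] at hcomp
  have h1 := mul_le_mul_of_nonneg_left hcomp hKr.le
  have h2 : a * empMean D (fun τ => u (τ 0).1) - (a * ∫ x, u x ∂M.d₁.toMeasure + a ^ 2) ≤
      L / (K * s) := by
    rw [le_div_iff₀ (by positivity)]
    nlinarith
  linarith

/-- Optimism: the maximizer of the empirical initial value over a confidence set that contains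
`fstar` overestimates the initial value of `fstar` up to the sampling error. -/
theorem integral_value_le_of_optimistic [NeZero H] {s : ℕ} (hK : 0 < K) (hs : 0 < s)
    {D : Dataset X A H K s} {ρ : ℕ → Policy X A H}
    (hρ : ∀ i : Fin s, pol i (dataPrefix i.isLt.le D) = ρ i) {u v : X → ℝ} (hu : ∀ x, |u x| ≤ 1)
    (hv : ∀ x, |v x| ≤ 1) {γ L : ℝ} (hγ : 0 < γ) (hLK : L ≤ K)
    (hexcu : excess pol (fun τ => -γ * u (τ 0).1) (compensator M fun τ => -γ * u (τ 0).1) D ≤ L)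
    (hexcv : excess pol (fun τ => γ * v (τ 0).1) (compensator M fun τ => γ * v (τ 0).1) D ≤ L)
    (huv : empMean D (fun τ => u (τ 0).1) ≤ empMean D (fun τ => v (τ 0).1)) :
    ∫ x, u x ∂M.d₁.toMeasure ≤ ∫ x, v x ∂M.d₁.toMeasure + (2 * γ + 2 / (s * γ)) := by
  have hKr : (0 : ℝ) < K := by exact_mod_cast hK
  have hsr : (0 : ℝ) < s := by exact_mod_cast hs
  have h1 := mul_empMean_value_le hK hs hρ hu hexcu
  have h2 := mul_empMean_value_le hK hs hρ hv hexcv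
  have h3 : L / (K * s) ≤ 1 / s := by
    rw [div_le_div_iff₀ (by positivity) hsr]
    nlinarith
  have h4 : γ * ∫ x, u x ∂M.d₁.toMeasure ≤
      γ * (∫ x, v x ∂M.d₁.toMeasure + (2 * γ + 2 / (s * γ))) := by
    have h5 : γ * (2 / (s * γ)) = 2 * (1 / s) := by field_simp
    have h6 := mul_le_mul_of_nonneg_left huv hγ.le
    rw [mul_add, mul_add, h5]
    nlinarith
  exact le_of_mul_le_mul_left h4 hγ

end

/-! ### The regret of a run -/

section

variable {X A : Type*} [Countable X] [MeasurableSpace X] [DiscreteMeasurableSpace X]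
  [Countable A] [MeasurableSpace A] [DiscreteMeasurableSpace A] {H K : ℕ}

theorem isFiniteRule_glowPolicy [NeZero H] {F : Set (ValueFn X A H)} (hF : F.Finite)
    {W : Set (WeightFn X A H)} {greedy : ValueFn X A H → Fin H → X → A} {T : ℕ} {γ δ : ℝ}
    {sel : (s : ℕ) → Dataset X A H K s → ValueFn X A H}
    (hsel : IsGlowSelection F W greedy T K γ δ sel) (s : ℕ) :
    IsFiniteRule (glowPolicy greedy sel s) :=
  IsFiniteRule.comp (g := sel s)
    ⟨hF.subset (Set.range_subset_iff.2 fun D => hsel.mem s D), hsel.measurable s⟩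
    fun f => detPolicy (greedy f)

/-- The functions to which concentration is applied: in round `s + 1`, the penalized residuals and
the initial values of all `f ∈ F`, with both signs. -/
noncomputable def testFunction [NeZero H] (greedy : ValueFn X A H → Fin H → X → A) (γ : ℝ) (s : ℕ)
    (h : Fin H) (w : WeightFn X A H) (f : ValueFn X A H) : Bool × Bool → Traj X A H → ℝ
  | (false, false) => fun τ => 1 / (17 * gammaAt γ s) * penalizedResidual f w (gammaAt γ s) h τ
  | (false, true) => fun τ => -(1 / (17 * gammaAt γ s)) * penalizedResidual f w (gammaAt γ s) h τ
  | (true, false) => fun τ => γ * f 0 (τ 0).1 (greedy f 0 (τ 0).1)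
  | (true, true) => fun τ => -γ * f 0 (τ 0).1 (greedy f 0 (τ 0).1)

theorem measurable_testFunction [NeZero H] (greedy : ValueFn X A H → Fin H → X → A) (γ : ℝ) (s : ℕ)
    (h : Fin H) (w : WeightFn X A H) (f : ValueFn X A H) (b : Bool × Bool) :
    Measurable (testFunction greedy γ s h w f b) := by
  have hv : Measurable fun τ : Traj X A H => f 0 (τ 0).1 (greedy f 0 (τ 0).1) :=
    (Measurable.of_discrete (f := fun x => f 0 x (greedy f 0 x))).comp
      (by fun_prop : Measurable fun τ : Traj X A H => (τ 0).1)
  rcases b with ⟨_ | _, _ | _⟩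
  · exact (measurable_penalizedResidual f w _ h).const_mul _
  · exact (measurable_penalizedResidual f w _ h).const_mul _
  · exact hv.const_mul _
  · exact hv.const_mul _

theorem abs_testFunction_le [NeZero H] (greedy : ValueFn X A H → Fin H → X → A) {γ : ℝ}
    (hγ : 0 < γ) (hγ1 : γ ≤ 1) (s : ℕ) (h : Fin H) (w : WeightFn X A H) {f : ValueFn X A H}
    (hf : ∀ h x a, f h x a ∈ Set.Icc (0 : ℝ) 1) (b : Bool × Bool) (τ : Traj X A H) :
    |testFunction greedy γ s h w f b τ| ≤ 1 := by
  have hc := gammaAt_pos hγ s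
  have h1 : |1 / (17 * gammaAt γ s) * penalizedResidual f w (gammaAt γ s) h τ| ≤ 1 := by
    have h2 := abs_penalizedResidual_le hf w hc h τ
    have h3 := clip_le (w h (τ h).1 (τ h).2.1) hc.le
    rw [abs_mul, abs_of_pos (by positivity), one_div_mul_eq_div, div_le_one (by positivity)]
    linarith
  have h4 : |γ * f 0 (τ 0).1 (greedy f 0 (τ 0).1)| ≤ 1 := by
    have h5 := hf 0 (τ 0).1 (greedy f 0 (τ 0).1)
    rw [abs_of_nonneg (mul_nonneg hγ.le h5.1)]
    exact mul_le_one₀ hγ1 h5.1 h5.2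
  rcases b with ⟨_ | _, _ | _⟩
  · exact h1
  · simpa only [testFunction, neg_mul, abs_neg] using h1
  · exact h4
  · simpa only [testFunction, neg_mul, abs_neg] using h4

/-- The deterministic part of the analysis: if all test functions concentrate along the data `D`,
then the regret of the run is controlled. -/
theorem regret_le_of_concentration [NeZero H] (M : MDP X A H) {πstar : Fin H → X → A}
    (hπ : M.IsOptimal πstar) {F : Set (ValueFn X A H)}
    (hF : ∀ f ∈ F, ∀ h x a, f h x a ∈ Set.Icc (0 : ℝ) 1)
    {greedy : ValueFn X A H → Fin H → X → A} (hgreedy : IsGreedyRule F greedy)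
    {W : Set (WeightFn X A H)} (hQ : M.Q (detPolicy πstar) ∈ F)
    (hW : DensityRatioRealizable M (policyClass F greedy) W)
    {γ δ C : ℝ} (hγ : 0 < γ) (hγ1 : γ ≤ 1)
    (hcov : coverability M (policyClass F greedy) < ENNReal.ofReal C) {T : ℕ} (hT : 1 ≤ T)
    (hK : 0 < K) {sel : (s : ℕ) → Dataset X A H K s → ValueFn X A H}
    (hsel : IsGlowSelection F (augmented W T) greedy T K γ δ sel) (hWne : W.Nonempty)
    {L : ℝ} (hL0 : 0 ≤ L)
    (hL : L = Real.log (6 * (F.ncard : ℝ) * ((augmented W T).ncard : ℝ) * (T : ℝ) * (H : ℝ) / δ))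
    (hLK : L ≤ K) {D : Dataset X A H K T}
    (hD : ∀ (s : Fin T) (h : Fin H) (w : augmented W T) (f : F) (b : Bool × Bool),
      excess (glowPolicy greedy sel) (testFunction greedy γ s h w f b)
        (compensator M (testFunction greedy γ s h w f b)) (dataPrefix s.isLt.le D) ≤ L) :
    ∑ t : Fin T, (M.J (detPolicy πstar) -
        M.J (glowPolicy greedy sel t fun i => D (Fin.castLE t.isLt.le i))) ≤
      1 + T * (2 * γ + 106 * H * γ) + 2 / γ * (1 + Real.log T) +
        H * (72 * C / γ * Real.log (1 + T)) := by
  have hKr : (0 : ℝ) < K := by exact_mod_cast hK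
  -- `φ s` is the function selected in round `s + 1`, with an arbitrary value beyond round `T + 1`
  let φ : ℕ → ValueFn X A H := fun s =>
    if h : s ≤ T then sel s (dataPrefix h D) else sel 0 Fin.elim0
  have hφ : ∀ s, φ s ∈ F := fun s => by
    simp only [φ]
    split_ifs <;> exact hsel.mem _ _
  have hφeq : ∀ (s : ℕ) (h : s ≤ T), φ s = sel s (dataPrefix h D) := fun s h => by simp [φ, h]
  have hρ : ∀ (s : ℕ) (h : s ≤ T) (i : Fin s),
      glowPolicy greedy sel i (dataPrefix i.isLt.le (dataPrefix h D)) =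
        (fun i => detPolicy (greedy (φ i))) (i : ℕ) := fun s h i => by
    simp only [hφeq i (i.isLt.le.trans h)]
    rfl
  have hsum : ∑ t : Fin T, (M.J (detPolicy πstar) -
        M.J (glowPolicy greedy sel t fun i => D (Fin.castLE t.isLt.le i))) =
      ∑ s ∈ Finset.range T, (M.J (detPolicy πstar) - M.J (detPolicy (greedy (φ s)))) := by
    rw [← Fin.sum_univ_eq_sum_range
      (fun s => M.J (detPolicy πstar) - M.J (detPolicy (greedy (φ s)))) T]
    refine Finset.sum_congr rfl fun t _ => ?_
    rw [hφeq t t.isLt.le]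
    rfl
  have hQF := hF _ hQ
  have hval : ∀ f ∈ F, ∀ x, |f 0 x (greedy f 0 x)| ≤ 1 := fun f hf x =>
    abs_le.2 ⟨by linarith [(hF f hf 0 x (greedy f 0 x)).1], (hF f hf 0 x (greedy f 0 x)).2⟩
  have hJ : M.J (detPolicy πstar) ≤
      ∫ x, M.Q (detPolicy πstar) 0 x (greedy (M.Q (detPolicy πstar)) 0 x) ∂M.d₁.toMeasure := by
    rw [hπ.J_eq M hQF]
    refine integral_mono ?_ (integrable_of_bounded Measurable.of_discrete (hval _ hQ))
      fun x => hgreedy _ hQ 0 x _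
    exact integrable_of_bounded (C := 1) Measurable.of_discrete fun x =>
      abs_le.2 ⟨by linarith [(hQF 0 x (πstar 0 x)).1], (hQF 0 x (πstar 0 x)).2⟩
  have hJ1 : M.J (detPolicy πstar) ≤ 1 :=
    hJ.trans ((le_abs_self _).trans (abs_integral_le_of_bounded (hval _ hQ)))
  have hne : ∀ s, 1 ≤ s → ∀ hs : s < T, M.Q (detPolicy πstar) ∈
      confidenceSet F (augmented W T) T K γ δ (dataPrefix hs.le D) := fun s hs1 hs => by
    refine ⟨hQ, fun h w hw => ?_⟩
    have := empMean_penalizedResidual_le (ρ := fun i => detPolicy (greedy (φ i))) hK hs1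
      (hρ s hs.le) hQF (gammaAt_pos hγ s) h
      (hπ.bellmanError_Q M h) hL0 (hD ⟨s, hs⟩ h ⟨w, hw⟩ ⟨_, hQ⟩ (false, false))
    rw [betaAt, ← hL]
    exact this
  rw [hsum]
  refine sum_regret_le M hF hgreedy hW hγ hγ1 hcov hφ hT hJ1 ?_ ?_
  · intro s hs1 hs
    obtain ⟨_, hmax⟩ := hsel.argmax s (dataPrefix hs.le D) ⟨_, hne s hs1 hs⟩
    have h1 := hmax _ (hne s hs1 hs)
    rw [← hφeq s hs.le] at h1
    -- these two test functions do not depend on the layer and the weight that index them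
    obtain ⟨w, hw⟩ := augmented_nonempty hWne hT
    refine hJ.trans (integral_value_le_of_optimistic
      (ρ := fun i => detPolicy (greedy (φ i))) hK hs1 (hρ s hs.le) (hval _ hQ)
      (hval _ (hφ s)) hγ hLK (hD ⟨s, hs⟩ 0 ⟨w, hw⟩ ⟨_, hQ⟩ (true, true))
      (hD ⟨s, hs⟩ 0 ⟨w, hw⟩ ⟨_, hφ s⟩ (true, false)) h1)
  · intro s hs1 hs h w hw
    obtain ⟨hmem, -⟩ := hsel.argmax s (dataPrefix hs.le D) ⟨_, hne s hs1 hs⟩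
    rw [← hφeq s hs.le] at hmem
    have hcon := hmem.2 h w hw
    rw [betaAt, ← hL] at hcon
    refine (sum_bellmanError_clip_le hK hs1 (hρ s hs.le) (hF _ (hφ s)) (gammaAt_pos hγ s) h
      (hD ⟨s, hs⟩ h ⟨w, hw⟩ ⟨_, hφ s⟩ (false, true)) hcon).trans ?_
    refine add_le_add ?_ le_rfl
    -- `γ⁽ᵗ⁾ / (t - 1) ≤ 2 γ` and `L ≤ K`
    have hsr : (1 : ℝ) ≤ s := by exact_mod_cast hs1
    rw [div_mul_eq_mul_div, div_le_iff₀ (by positivity), gammaAt]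
    have h2 : γ * (s + 1) * L ≤ γ * (2 * s) * K := by
      have : γ * (s + 1) ≤ γ * (2 * s) := mul_le_mul_of_nonneg_left (by linarith) hγ.le
      exact mul_le_mul this hLK hL0 (by positivity)
    linarith

end

/-! ### Parameters -/

/-- With `T ≥ 10 ^ 10 * x * ℓ ^ 2`, the factor `log T` of the regret bound is absorbed. Since `T`
may exceed its lower bound by any factor, the proof compares `√T` with the root `y` of that bound. -/
theorem sqrt_mul_log_le_sqrt {x ℓ T : ℝ} (hx : 1 ≤ x) (hℓ : 1 ≤ ℓ) (hxℓ : Real.log x ≤ ℓ)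
    (hT : 10 ^ 10 * x * ℓ ^ 2 ≤ T) : 401 * √x * Real.log T ≤ √T := by
  have hx0 : 0 < x := by linarith
  have hsx : 0 < √x := Real.sqrt_pos.2 hx0
  have hT0 : 0 < T := lt_of_lt_of_le (by positivity) hT
  set y := 10 ^ 5 * √x * ℓ with hy
  have hy0 : 0 < y := by positivity
  have hysq : y ^ 2 = 10 ^ 10 * x * ℓ ^ 2 := by
    rw [hy, mul_pow, mul_pow, Real.sq_sqrt hx0.le]; norm_num
  have hyT : y ≤ √T := Real.le_sqrt_of_sq_le (by rw [hysq]; exact hT)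
  have ha : 1 ≤ √T / y := by rwa [le_div_iff₀ hy0, one_mul]
  have hlogT : Real.log T = 2 * (Real.log (√T / y) + Real.log y) := by
    rw [Real.log_div (Real.sqrt_pos.2 hT0).ne' hy0.ne', Real.log_sqrt hT0.le]; ring
  have hloga : Real.log (√T / y) ≤ √T / y - 1 := Real.log_le_sub_one_of_pos (by positivity)
  have hlogy : Real.log y ≤ 45 + ℓ / 2 + (ℓ - 1) := by
    rw [hy, Real.log_mul (by positivity) (by positivity), Real.log_mul (by positivity)
      (by positivity), Real.log_pow, Real.log_sqrt hx0.le]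
    have h1 : Real.log 10 ≤ 10 - 1 := Real.log_le_sub_one_of_pos (by norm_num)
    have h2 : Real.log ℓ ≤ ℓ - 1 := Real.log_le_sub_one_of_pos (by linarith)
    push_cast
    linarith
  have h3 : Real.log T ≤ 95 * ℓ * (√T / y) := by
    have : ℓ ≤ ℓ * (√T / y) := le_mul_of_one_le_right (by linarith) ha
    have : √T / y ≤ ℓ * (√T / y) := le_mul_of_one_le_left (by positivity) hℓ
    linarith
  calc 401 * √x * Real.log T ≤ 401 * √x * (95 * ℓ * (√T / y)) :=
        mul_le_mul_of_nonneg_left h3 (by positivity)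
    _ = 38095 * √x * ℓ * (√T / y) := by ring
    _ ≤ y * (√T / y) := by
        refine mul_le_mul_of_nonneg_right ?_ (by positivity)
        rw [hy]
        have : 0 < √x * ℓ := by positivity
        nlinarith
    _ = √T := by field_simp

/-- The total regret bound, divided by `T`, is at most `ε`. -/
theorem regret_bound_div_le {H C T γ ε ℓ : ℝ} (hH : 1 ≤ H) (hC : 1 ≤ C) (hε : 0 < ε) (hε1 : ε ≤ 1)
    (hℓ : 1 ≤ ℓ) (hxℓ : Real.log (H ^ 2 * C / ε ^ 2) ≤ ℓ)
    (hT : 10 ^ 10 * (H ^ 2 * C / ε ^ 2) * ℓ ^ 2 ≤ T) (hγ : γ = √(C / T)) :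
    (1 + T * (2 * γ + 106 * H * γ) + 2 / γ * (1 + Real.log T) +
      H * (72 * (2 * C) / γ * Real.log (1 + T))) / T ≤ ε := by
  have hCx : C ≤ H ^ 2 * C / ε ^ 2 := by
    rw [le_div_iff₀ (by positivity)]
    have h1 : ε ^ 2 ≤ 1 := pow_le_one₀ hε.le hε1
    have h2 : (1 : ℝ) ≤ H ^ 2 := one_le_pow₀ hH
    nlinarith
  set x := H ^ 2 * C / ε ^ 2 with hx
  have hx1 : 1 ≤ x := hC.trans hCx
  have hTx : 10 ^ 10 * x ≤ T := by
    refine le_trans ?_ hT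
    exact le_mul_of_one_le_right (by positivity) (one_le_pow₀ hℓ)
  have hT10 : 10 ^ 10 ≤ T := by linarith
  have hT0 : 0 < T := by linarith
  have hCT : C ≤ T := by linarith
  have hγ0 : 0 < γ := by rw [hγ]; exact Real.sqrt_pos.2 (by positivity)
  have hγ2 : γ ^ 2 * T = C := by
    rw [hγ, Real.sq_sqrt (by positivity)]; field_simp
  have hlog1 : 1 ≤ Real.log T := by
    rw [Real.le_log_iff_exp_le hT0]
    linarith [Real.exp_one_lt_d9]
  have hlog2 : Real.log (1 + T) ≤ 2 * Real.log T := by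
    have h3 : Real.log (1 + T) ≤ Real.log (T ^ 2) :=
      Real.log_le_log (by linarith) (by nlinarith)
    rwa [Real.log_pow] at h3
  have hCγ : C / γ = γ * T := by
    rw [div_eq_iff hγ0.ne']; linarith
  have h1γ : 1 / γ ≤ γ * T := by
    rw [← hCγ]
    exact div_le_div_of_nonneg_right hC hγ0.le
  have hγ1 : γ ≤ 1 := by
    rw [hγ]
    exact Real.sqrt_le_one.2 (by rw [div_le_one hT0]; exact hCT)
  have hone : 1 ≤ γ * T := le_trans (by rw [le_div_iff₀ hγ0]; linarith) h1γ
  have hmain : 401 * H * γ * Real.log T ≤ ε := by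
    have h4 := sqrt_mul_log_le_sqrt hx1 hℓ hxℓ hT
    have h5 : H * γ * √T = ε * √x := by
      have h6 : H * γ * √T = √((H * γ * √T) ^ 2) := (Real.sqrt_sq (by positivity)).symm
      have h7 : ε * √x = √((ε * √x) ^ 2) := (Real.sqrt_sq (by positivity)).symm
      rw [h6, h7]
      congr 1
      rw [mul_pow, mul_pow, mul_pow, Real.sq_sqrt hT0.le, Real.sq_sqrt (by linarith), hx,
        mul_assoc, hγ2]
      field_simp
    have hsT : 0 < √T := Real.sqrt_pos.2 hT0
    refine le_of_mul_le_mul_right ?_ hsT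
    calc 401 * H * γ * Real.log T * √T = (H * γ * √T) * (401 * Real.log T) := by ring
      _ = ε * (401 * √x * Real.log T) := by rw [h5]; ring
      _ ≤ ε * √T := mul_le_mul_of_nonneg_left h4 hε.le
  refine le_trans ?_ hmain
  rw [div_le_iff₀ hT0]
  have e1 : 2 / γ * (1 + Real.log T) ≤ 4 * (γ * T) * Real.log T := by
    have h8 : 2 / γ = 2 * (1 / γ) := by ring
    rw [h8]
    have h9 : (1 / γ) * (1 + Real.log T) ≤ γ * T * (2 * Real.log T) :=
      mul_le_mul h1γ (by linarith) (by linarith) (by positivity)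
    linarith
  have e2 : 72 * (2 * C) / γ * Real.log (1 + T) ≤ 288 * (γ * T) * Real.log T := by
    have h10 : 72 * (2 * C) / γ = 144 * (C / γ) := by ring
    rw [h10, hCγ]
    have := mul_le_mul_of_nonneg_left hlog2 (show 0 ≤ 144 * (γ * T) by positivity)
    linarith
  set G := γ * T * Real.log T with hG
  have hG1 : γ * T ≤ G := le_mul_of_one_le_right (by positivity) hlog1
  have hGH : G ≤ H * G := le_mul_of_one_le_left (by positivity) hH
  have e3 : T * (2 * γ + 106 * H * γ) ≤ 2 * G + 106 * (H * G) := by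
    have : H * (γ * T) ≤ H * G := mul_le_mul_of_nonneg_left hG1 (by linarith)
    nlinarith
  have e4 := mul_le_mul_of_nonneg_left e2 (show 0 ≤ H by linarith)
  have e5 : H * (288 * (γ * T) * Real.log T) = 288 * (H * G) := by rw [hG]; ring
  have e6 : 4 * (γ * T) * Real.log T = 4 * G := by rw [hG]; ring
  have e7 : 401 * H * γ * Real.log T * T = 401 * (H * G) := by rw [hG]; ring
  rw [e7]
  linarith

/-- The logarithm of the size of the augmented class is at most `T` times that of the original
class, up to logarithmic terms; hence the prescribed `K` suffices. -/
theorem log_augmented_le {N W Wbar T H δ : ℝ} {n : ℕ} (hn : T = n) (hN : 1 ≤ N) (hW : 1 ≤ W)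
    (hWbar : 1 ≤ Wbar) (hle : Wbar ≤ T * W ^ n) (hT : 1 ≤ T) (hH : 1 ≤ H) (hδ : 0 < δ)
    (hδ1 : δ ≤ 1) :
    Real.log (6 * N * Wbar * T * H / δ) ≤ 2 * T * Real.log (6 * N * W * H * T / δ) := by
  have hNH : 1 ≤ N * H := one_le_mul_of_one_le_of_one_le hN hH
  set a := 6 * N * H * T / δ with ha
  have haT : T ≤ a := by
    rw [ha, le_div_iff₀ hδ]
    nlinarith
  have ha1 : 1 ≤ a := hT.trans haT
  have h1 : 6 * N * Wbar * T * H / δ ≤ (a * W) ^ (2 * n) := by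
    have hn1 : 1 ≤ n := by rw [hn] at hT; exact_mod_cast hT
    calc 6 * N * Wbar * T * H / δ = a * Wbar := by rw [ha]; ring
      _ ≤ a * (T * W ^ n) := mul_le_mul_of_nonneg_left hle (by linarith)
      _ ≤ a * (a * W ^ n) := by gcongr
      _ = a ^ 2 * W ^ n := by ring
      _ ≤ a ^ (2 * n) * W ^ (2 * n) := by
          gcongr
          · omega
          · omega
      _ = (a * W) ^ (2 * n) := (mul_pow _ _ _).symm
  have h2 : 6 * N * W * H * T / δ = a * W := by rw [ha]; ring
  rw [h2]
  refine (Real.log_le_log (by positivity) h1).trans (le_of_eq ?_)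
  rw [Real.log_pow, hn]
  push_cast
  ring

/-- The number of trajectories for the prescribed `T` and `K`. -/
theorem sample_count_le {c κ x ℓ H B T K : ℝ} (hc : 1 ≤ c) (hκ : 1 ≤ κ) (hx : 1 ≤ x)
    (hxℓ : Real.log x ≤ ℓ) (hℓ : 1 ≤ ℓ) (hH : 1 ≤ H) (hHx : H ≤ x) (hB : 1 ≤ B) (hT1 : 1 ≤ T)
    (hT : T ≤ κ * (c * x * ℓ ^ 2)) (hK : K ≤ κ * (2 * T * Real.log (6 * (B * H * T)))) :
    T * K ≤ 2 * κ ^ 3 * c ^ 2 * (9 + Real.log (κ * c)) * x ^ 2 * (1 + Real.log B) * ℓ ^ 5 := by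
  have hlB : 0 ≤ Real.log B := Real.log_nonneg hB
  have hlκ : 0 ≤ Real.log (κ * c) :=
    Real.log_nonneg (one_le_mul_of_one_le_of_one_le hκ hc)
  have hlogT : Real.log T ≤ Real.log (κ * c) + ℓ + 2 * ℓ := by
    refine (Real.log_le_log (by linarith) hT).trans ?_
    have h1 : κ * (c * x * ℓ ^ 2) = κ * c * x * ℓ ^ 2 := by ring
    rw [h1, Real.log_mul (by positivity) (by positivity),
      Real.log_mul (by positivity) (by positivity), Real.log_pow]
    have : Real.log ℓ ≤ ℓ - 1 := Real.log_le_sub_one_of_pos (by linarith)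
    push_cast
    linarith
  have hlogH : Real.log H ≤ ℓ := (Real.log_le_log (by linarith) hHx).trans hxℓ
  have hlog : Real.log (6 * (B * H * T)) ≤ (9 + Real.log (κ * c)) * ℓ * (1 + Real.log B) := by
    rw [Real.log_mul (by norm_num) (by positivity), Real.log_mul (by positivity) (by positivity),
      Real.log_mul (by positivity) (by positivity)]
    have h6 : Real.log 6 ≤ 6 - 1 := Real.log_le_sub_one_of_pos (by norm_num)
    have h7 : Real.log (κ * c) ≤ Real.log (κ * c) * ℓ := le_mul_of_one_le_right hlκ hℓ
    have h8 : Real.log B ≤ 1 * ℓ * Real.log B := by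
      rw [one_mul]; exact le_mul_of_one_le_left hlB hℓ
    have h9 : 1 * ℓ * Real.log B ≤ (9 + Real.log (κ * c)) * ℓ * Real.log B :=
      mul_le_mul_of_nonneg_right (mul_le_mul_of_nonneg_right (by linarith) (by linarith)) hlB
    nlinarith
  have hT2 : T ^ 2 ≤ (κ * (c * x * ℓ ^ 2)) ^ 2 := pow_le_pow_left₀ (by linarith) hT 2
  calc T * K ≤ T * (κ * (2 * T * Real.log (6 * (B * H * T)))) :=
        mul_le_mul_of_nonneg_left hK (by linarith)
    _ = 2 * κ * (T ^ 2 * Real.log (6 * (B * H * T))) := by ring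
    _ ≤ 2 * κ * ((κ * (c * x * ℓ ^ 2)) ^ 2 *
          ((9 + Real.log (κ * c)) * ℓ * (1 + Real.log B))) := by
        refine mul_le_mul_of_nonneg_left (mul_le_mul hT2 hlog ?_ (by positivity)) (by linarith)
        exact Real.log_nonneg (by
          nlinarith [one_le_mul_of_one_le_of_one_le (one_le_mul_of_one_le_of_one_le hB hH) hT1])
    _ = _ := by ring

section

variable {X A : Type*} [Countable X] [MeasurableSpace X] [DiscreteMeasurableSpace X]
  [Countable A] [MeasurableSpace A] [DiscreteMeasurableSpace A] {H K : ℕ}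

/-! ### High-probability regret bound -/

/-- With probability at least `1 - δ`, all test functions concentrate, and the regret is
controlled. The number of test functions is `4 * T * H * |F| * |W̄|`, and each of them fails to
concentrate with probability at most `δ / (6 * T * H * |F| * |W̄|)`. -/
theorem one_sub_le_dataLaw_risk_le [NeZero H] (M : MDP X A H) {πstar : Fin H → X → A}
    (hπ : M.IsOptimal πstar) {F : Set (ValueFn X A H)} (hFfin : F.Finite)
    (hF : ∀ f ∈ F, ∀ h x a, f h x a ∈ Set.Icc (0 : ℝ) 1)
    {greedy : ValueFn X A H → Fin H → X → A} (hgreedy : IsGreedyRule F greedy)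
    {W : Set (WeightFn X A H)} (hWfin : W.Finite) (hQ : M.Q (detPolicy πstar) ∈ F)
    (hW : DensityRatioRealizable M (policyClass F greedy) W)
    {γ δ C ε : ℝ} (hγ : 0 < γ) (hγ1 : γ ≤ 1) (hδ : 0 < δ) (hδ1 : δ ≤ 1)
    (hcov : coverability M (policyClass F greedy) < ENNReal.ofReal C) {T : ℕ} (hT : 1 ≤ T)
    (hK : 0 < K) {sel : (s : ℕ) → Dataset X A H K s → ValueFn X A H}
    (hsel : IsGlowSelection F (augmented W T) greedy T K γ δ sel)
    (hWne : W.Nonempty)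
    (hLK : Real.log (6 * (F.ncard : ℝ) * ((augmented W T).ncard : ℝ) * (T : ℝ) * (H : ℝ) / δ) ≤ K)
    (hε : (1 + T * (2 * γ + 106 * H * γ) + 2 / γ * (1 + Real.log T) +
        H * (72 * C / γ * Real.log (1 + T))) / T ≤ ε) :
    ENNReal.ofReal (1 - δ) ≤ dataLaw M K (glowPolicy greedy sel) T
      {D | risk M (detPolicy πstar) (glowPolicy greedy sel) D ≤ ε} := by
  have hWbfin := finite_augmented hWfin T
  have := hFfin.to_subtype
  have := hWbfin.to_subtype
  have hN : (1 : ℝ) ≤ F.ncard := by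
    exact_mod_cast (Set.ncard_pos hFfin).2 ⟨_, hQ⟩
  have hWb : (1 : ℝ) ≤ (augmented W T).ncard := by
    exact_mod_cast (Set.ncard_pos hWbfin).2 (augmented_nonempty hWne hT)
  have hTr : (1 : ℝ) ≤ T := by exact_mod_cast hT
  have hHr : (1 : ℝ) ≤ H := by exact_mod_cast NeZero.pos H
  set q : ℝ := (F.ncard : ℝ) * ((augmented W T).ncard : ℝ) * (T : ℝ) * (H : ℝ) with hq
  have hq1 : 1 ≤ q := one_le_mul_of_one_le_of_one_le (one_le_mul_of_one_le_of_one_le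
    (one_le_mul_of_one_le_of_one_le hN hWb) hTr) hHr
  have harg : 6 * (F.ncard : ℝ) * ((augmented W T).ncard : ℝ) * (T : ℝ) * (H : ℝ) / δ =
      6 * q / δ := by rw [hq]; ring
  have hL0 : 0 ≤ Real.log (6 * (F.ncard : ℝ) * ((augmented W T).ncard : ℝ) * T * H / δ) := by
    rw [harg]
    refine Real.log_nonneg ?_
    rw [le_div_iff₀ hδ]
    linarith
  have hgood := one_sub_le_dataLaw_forall_excess_le (M := M) (K := K)
    (pol := glowPolicy greedy sel) (isFiniteRule_glowPolicy hFfin hsel)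
    (fun i : Fin T × Fin H × augmented W T × F × (Bool × Bool) =>
      testFunction greedy γ i.1 i.2.1 i.2.2.1 i.2.2.2.1 i.2.2.2.2)
    (fun i => measurable_testFunction greedy γ _ _ _ _ _)
    (fun i => abs_testFunction_le greedy hγ hγ1 _ _ _ (hF _ i.2.2.2.1.2) _)
    (fun i => (i.1 : ℕ)) (fun i => i.1.isLt.le)
    (L := Real.log (6 * (F.ncard : ℝ) * ((augmented W T).ncard : ℝ) * T * H / δ)) (δ := δ) (by
      rw [harg, Real.exp_neg, Real.exp_log (by positivity)]
      simp only [Nat.card_prod, Nat.card_fin, Nat.card_coe_set_eq,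
        Nat.card_eq_fintype_card (α := Bool), Fintype.card_bool]
      push_cast
      have : (T : ℝ) * (H * ((augmented W T).ncard * (F.ncard * 4))) = 4 * q := by
        rw [hq]; ring
      rw [this, inv_div, mul_div_assoc', div_le_iff₀ (by positivity)]
      nlinarith)
  refine hgood.trans (measure_mono fun D hD => ?_)
  have hreg := regret_le_of_concentration M hπ hF hgreedy hQ hW hγ hγ1 hcov hT hK hsel hWne hL0
    rfl hLK (D := D) fun s h w f b => hD (s, h, w, f, b)
  exact (div_le_div_of_nonneg_right hreg (by positivity)).trans hε

end

end Glow

theorem mainTheorem2 :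
    -- `C₁` is an absolute constant, and `C₂` depends on `κ` only
    ∃ C₁ : ℝ, 0 < C₁ ∧ ∀ κ : ℝ, 1 ≤ κ → ∃ C₂ : ℝ, 0 < C₂ ∧
    ∀ (X A : Type*) [Countable X] [MeasurableSpace X] [DiscreteMeasurableSpace X]
      [Countable A] [MeasurableSpace A] [DiscreteMeasurableSpace A]
      (H : ℕ) [NeZero H] (M : Glow.MDP X A H) (_ : M.RewardsNormalized)
      (πstar : Fin H → X → A) (_ : M.IsOptimal πstar)
      -- the value function class and the greedy policies
      (F : Set (Glow.ValueFn X A H)) (_ : F.Finite)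
      (_ : ∀ f ∈ F, ∀ h x a, f h x a ∈ Set.Icc (0 : ℝ) 1)
      (greedy : Glow.ValueFn X A H → Fin H → X → A) (_ : Glow.IsGreedyRule F greedy)
      -- the weight function class
      (W : Set (Glow.WeightFn X A H)) (_ : W.Finite)
      -- the two realizability assumptions
      (_ : M.Q (Glow.detPolicy πstar) ∈ F)
      (_ : Glow.DensityRatioRealizable M (Glow.policyClass F greedy) W)
      (ε δ : ℝ) (_ : 0 < ε) (_ : ε ≤ 1) (_ : 0 < δ) (_ : δ < 1)
      (Ccov : ℝ) (_ : Ccov = (Glow.coverability M (Glow.policyClass F greedy)).toReal)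
      -- `T`, up to a factor `κ`, and `K`, up to a factor `κ`
      (T K : ℕ) (Tmin Kmin : ℝ)
      (_ : Tmin = C₁ * ((H : ℝ) ^ 2 * Ccov / ε ^ 2) *
        Real.log (Real.exp 1 + (H : ℝ) ^ 2 * Ccov / ε ^ 2) ^ 2)
      (_ : Tmin ≤ T) (_ : T ≤ κ * Tmin)
      (_ : Kmin = 2 * T * Real.log (6 * F.ncard * W.ncard * H * T / δ))
      (_ : Kmin ≤ K) (_ : K ≤ κ * Kmin)
      (γ : ℝ) (_ : γ = √(Ccov / T))
      -- a run of the algorithm on the classes `F` and `Glow.augmented W T`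
      (sel : (s : ℕ) → Glow.Dataset X A H K s → Glow.ValueFn X A H)
      (_ : Glow.IsGlowSelection F (Glow.augmented W T) greedy T K γ δ sel),
      -- with probability at least `1 - δ` the output is `ε`-suboptimal
      ENNReal.ofReal (1 - δ) ≤
        Glow.dataLaw M K (Glow.glowPolicy greedy sel) T
          {D | Glow.risk M (Glow.detPolicy πstar) (Glow.glowPolicy greedy sel) D ≤ ε} ∧
      -- the number of trajectories collected in the `T` rounds with `K` trajectories each
      (T : ℝ) * K ≤ C₂ * ((H : ℝ) ^ 4 * Ccov ^ 2 / ε ^ 4) *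
        (1 + Real.log (F.ncard * W.ncard / δ)) *
        Real.log (Real.exp 1 + (H : ℝ) ^ 2 * Ccov / ε ^ 2) ^ 5 := by
  -- `√C₁ = 10 ^ 5` has to exceed the constant `401 * 95` in `Glow.sqrt_mul_log_le_sqrt`
  refine ⟨10 ^ 10, by norm_num, fun κ hκ => ?_⟩
  have hlogκ : 0 ≤ Real.log (κ * 10 ^ 10) := Real.log_nonneg (by linarith)
  refine ⟨2 * κ ^ 3 * (10 ^ 10) ^ 2 * (9 + Real.log (κ * 10 ^ 10)), by positivity, ?_⟩
  intro X A _ _ _ _ _ _ H _ M _ πstar hπ F hFfin hF greedy hgreedy W hWfin hQ hW ε δ hε hε1 hδ hδ1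
    Ccov hCcov T K Tmin Kmin hTmin hT hTκ hKmin hK hKκ γ hγ sel hsel
  -- the classes are nonempty, and the coverability coefficient is a real number `≥ 1`
  have hPne : (Glow.policyClass F greedy).Nonempty := ⟨_, _, hQ, rfl⟩
  have hWne : W.Nonempty := by
    obtain ⟨π, hmem⟩ := hPne
    obtain ⟨w, hw, -⟩ := hW π hmem π hmem 0
    exact ⟨w, hw⟩
  have hcovt := Glow.coverability_ne_top M hFfin ⟨_, hQ⟩ greedy
  have hC1 : 1 ≤ Ccov := by
    rw [hCcov]
    simpa using ENNReal.toReal_mono hcovt (Glow.one_le_coverability M hPne)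
  have hcov : Glow.coverability M (Glow.policyClass F greedy) < ENNReal.ofReal (2 * Ccov) := by
    rw [← ENNReal.ofReal_toReal hcovt, ← hCcov]
    exact (ENNReal.ofReal_lt_ofReal_iff (by linarith)).2 (by linarith)
  have hN : (1 : ℝ) ≤ F.ncard := by exact_mod_cast (Set.ncard_pos hFfin).2 ⟨_, hQ⟩
  have hWc : (1 : ℝ) ≤ W.ncard := by exact_mod_cast (Set.ncard_pos hWfin).2 hWne
  have hHr : (1 : ℝ) ≤ H := by exact_mod_cast NeZero.pos H
  set x : ℝ := (H : ℝ) ^ 2 * Ccov / ε ^ 2 with hx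
  have hε2 : ε ^ 2 ≤ 1 := pow_le_one₀ hε.le hε1
  have hHx : (H : ℝ) ≤ x := by
    rw [hx, le_div_iff₀ (by positivity)]
    nlinarith [mul_le_mul_of_nonneg_left hC1 (show (0 : ℝ) ≤ (H : ℝ) ^ 2 by positivity)]
  have hCx : Ccov ≤ x := by
    rw [hx, le_div_iff₀ (by positivity)]
    have : (1 : ℝ) ≤ (H : ℝ) ^ 2 := one_le_pow₀ hHr
    nlinarith
  have hx1 : 1 ≤ x := hHr.trans hHx
  set ℓ : ℝ := Real.log (Real.exp 1 + x) with hℓdef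
  have hℓ : 1 ≤ ℓ := by
    rw [hℓdef, Real.le_log_iff_exp_le (by positivity)]
    linarith
  have hxℓ : Real.log x ≤ ℓ :=
    Real.log_le_log (by linarith) (by linarith [Real.exp_pos 1])
  have hTlow : 10 ^ 10 * x * ℓ ^ 2 ≤ T := hTmin ▸ hT
  have hTx : 10 ^ 10 * x ≤ T :=
    le_trans (le_mul_of_one_le_right (by positivity) (one_le_pow₀ hℓ)) hTlow
  have hT10 : (10 : ℝ) ^ 10 ≤ T := by linarith
  have hT1 : (1 : ℝ) ≤ T := by linarith
  have hTn : 1 ≤ T := by exact_mod_cast hT1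
  have hγ0 : 0 < γ := by rw [hγ]; exact Real.sqrt_pos.2 (by positivity)
  have hγ1 : γ ≤ 1 := by
    rw [hγ]
    exact Real.sqrt_le_one.2 (by rw [div_le_one (by positivity)]; linarith)
  have hNW : (1 : ℝ) ≤ F.ncard * W.ncard := one_le_mul_of_one_le_of_one_le hN hWc
  have hB : (1 : ℝ) ≤ F.ncard * W.ncard / δ := by
    rw [le_div_iff₀ hδ]; linarith
  have harg : 6 * (F.ncard : ℝ) * W.ncard * H * T / δ =
      6 * ((F.ncard * W.ncard / δ) * H * T) := by ring
  have hlogpos : 0 < Real.log (6 * (F.ncard : ℝ) * W.ncard * H * T / δ) := by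
    rw [harg]
    refine Real.log_pos ?_
    nlinarith [one_le_mul_of_one_le_of_one_le (one_le_mul_of_one_le_of_one_le hB hHr) hT1]
  have hK0 : 0 < K := by
    have : (0 : ℝ) < K := lt_of_lt_of_le (by rw [hKmin]; positivity) hK
    exact_mod_cast this
  have hWbne := Glow.augmented_nonempty hWne hTn
  have hLK : Real.log (6 * (F.ncard : ℝ) * ((Glow.augmented W T).ncard : ℝ) * T * H / δ) ≤ K := by
    refine le_trans (Glow.log_augmented_le (n := T) rfl hN hWc ?_ ?_ hT1 hHr hδ hδ1.le)
      (hKmin ▸ hK)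
    · exact_mod_cast (Set.ncard_pos (Glow.finite_augmented hWfin T)).2 hWbne
    · exact_mod_cast Glow.ncard_augmented_le hWfin hWne T
  refine ⟨Glow.one_sub_le_dataLaw_risk_le M hπ hFfin hF hgreedy hWfin hQ hW hγ0 hγ1 hδ hδ1.le hcov
    hTn hK0 hsel hWne hLK (Glow.regret_bound_div_le hHr hC1 hε hε1 hℓ hxℓ hTlow hγ), ?_⟩
  have hx2 : (H : ℝ) ^ 4 * Ccov ^ 2 / ε ^ 4 = x ^ 2 := by
    rw [hx]; ring
  rw [hx2]
  refine Glow.sample_count_le (c := 10 ^ 10) (by norm_num) hκ hx1 hxℓ hℓ hHr hHx hB hT1 ?_ ?_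
  · rw [← hTmin]; exact hTκ
  · rw [← harg, ← hKmin]; exact hKκ
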